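/- Here a $\lambda$-ring means a commutative ring $R$ with operations $\lambda^n : R \to R$ ($n \ge 0$) such that $\lambda^0(x)=1$, $\lambda^1(x)=x$, $\lambda^n(x+y)=\sum_{i+j=n}\lambda^i(x)\lambda^j(y)$, $\lambda^n(1)=0$ for $n\ge 2$, and $$\lambda^n(xy)=P_n(\lambda^1 x,\dots,\lambda^n x;\lambda^1 y,\dots,\lambda^n y),\qquad \lambda^m(\lambda^n x)=P_{m,n}(\lambda^1x,\dots,\lambda^{mn}x),$$ where $P_n$ and $P_{m,n}$ are the unique integer polynomials such that $P_n(e_1(\xi),\dots,e_n(\xi);e_1(\eta),\dots,e_n(\eta))$ is the $n$-th elementary symmetric polynomial of the products $\xi_i\eta_j$ ($1\le i,j\le n$), and $P_{m,n}(e_1(\xi),\dots,e_{mn}(\xi))$ is the $m$-th elementary symmetric polynomial of the products $\xi_{i_1}\cdots\xi_{i_n}$ ($1\le i_1<\dots<i_n\le mn$). (These are the special $\lambda$-rings of the older terminology.) A homomorphism of $\lambda$-rings is a ring homomorphism commuting with all $\lambda^n$. For a symmetric function $f\in\Lambda=\mathbb{Z}[e_1,e_2,\dots]$ and $x\in R$,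 let $f(x)\in R$ be the image of $f$ under the ring homomorphism $\Lambda\to R$, $e_n\mapsto\lambda^n(x)$. An element $x\in R$ is called Schur-finite if there is a partition $\nu$ such that $s_\mu(x)=0$ for every partition $\mu$ whose Young diagram contains that of $\nu$, where $s_\mu$ is the Schur polynomial of $\mu$. An element $\ell$ is called a line element if $\lambda^n(\ell)=0$ for all $n>1$. For a commutative ring $A$, the big Witt ring $W(A)$ is the set $1+tA[[t]]$, with addition the multiplication of power series (so that zero is the series $1$), with unit $1+t$, with multiplication $$\Big(1+\sum_{n\ge1} a_nt^n\Big)*\Big(1+\sum_{n\ge1} b_nt^n\Big)=1+\sum_{n\ge1}P_n(a_1,\dots,a_n;b_1,\dots,b_n)t^n,$$ and with operations $\lambda^m\big(1+\sum_{n\ge1} a_nt^n\big)=1+\sum_{n\ge1}P_{n,m}(a_1,\dots,a_{nm})t^n$. **Proposition.** Let $R$ be a $\lambda$-ring that is an integral domain, and let $E$ be the algebraic closure of the fraction field of $R$. Then $R'=W(E)$ is a $\lambda$-ring, the map $\iota : R\to R'$, $x\mapsto \sum_{n\ge0}\lambda^n(x)t^n$, is an injective homomorphism of $\lambda$-rings,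 and for every Schur-finite element $x\in R$ there are $p,q\ge0$ and line elements $\ell_1,\dots,\ell_p,\ell'_1,\dots,\ell'_q$ of $R'$ such that $$\iota(x)=\sum_{i=1}^p\ell_i-\sum_{j=1}^q\ell'_j .$$ -/

import Mathlib

namespace LambdaTheory
open MvPolynomial

section UniversalPolynomials

theorem prod_one_add_mul {σ A : Type*} [CommRing A] (s : Finset σ) (v : σ → A) (t : A) :
    ∏ i ∈ s, (1 + v i * t) =
      ∑ k ∈ Finset.range (s.card + 1), (s.val.map v).esymm k * t ^ k := by
  classical
  rw [Finset.prod_one_add, Finset.sum_powerset]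
  refine Finset.sum_congr rfl fun k _ => ?_
  rw [Finset.esymm_map_val, Finset.sum_mul]
  refine Finset.sum_congr rfl fun u hu => ?_
  rw [Finset.prod_mul_distrib, Finset.prod_const, (Finset.mem_powersetCard.1 hu).2]

theorem esymm_eq_zero_of_card_lt {A : Type*} [CommRing A] (s : Multiset A) (n : ℕ)
    (h : s.card < n) : s.esymm n = 0 := by
  rw [Multiset.esymm, Multiset.powersetCard_eq_empty _ h]; simp

theorem coeff_prod_one_add {σ A : Type*} [CommRing A] (s : Finset σ) (v : σ → A) (n : ℕ) :
    (∏ i ∈ s, (1 + Polynomial.C (v i) * Polynomial.X : Polynomial A)).coeff n =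
      (s.val.map v).esymm n := by
  rw [prod_one_add_mul, Polynomial.finsetSum_coeff]
  have key : ∀ k, (s.val.map fun i => Polynomial.C (v i)).esymm k =
      Polynomial.C ((s.val.map v).esymm k) := by
    intro k
    simp [Finset.esymm_map_val, map_sum, map_prod]
  simp only [key, Polynomial.coeff_C_mul_X_pow]
  by_cases h : n ≤ s.card
  · rw [Finset.sum_eq_single n] <;> grind
  · rw [esymm_eq_zero_of_card_lt _ _ (by simpa using h)]
    refine Finset.sum_eq_zero fun k hk => ?_
    grind

/-- The `n`-th elementary symmetric polynomial of the products `x_i y_j`, `1 ≤ i, j ≤ n`. -/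
noncomputable def prodTarget (n : ℕ) : MvPolynomial (Fin n ⊕ Fin n) ℤ :=
  ((Finset.univ : Finset (Fin n × Fin n)).val.map
    (fun p => X (Sum.inl p.1) * X (Sum.inr p.2))).esymm n

/-- The elementary symmetric polynomials `e_1(x), …, e_n(x)` and `e_1(y), …, e_n(y)`
of two families `x_1, …, x_n` and `y_1, …, y_n`. -/
noncomputable def elemPair (n : ℕ) : Fin n ⊕ Fin n → MvPolynomial (Fin n ⊕ Fin n) ℤ :=
  Sum.elim (fun i => rename Sum.inl (esymm (Fin n) ℤ (i + 1)))
    (fun j => rename Sum.inr (esymm (Fin n) ℤ (j + 1)))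

theorem elemPair_algebraicIndependent (n : ℕ) : AlgebraicIndependent ℤ (elemPair n) := by
  have h1 : ∀ (B : Type) [CommRing B],
      AlgebraicIndependent B (fun i : Fin n => esymm (Fin n) B (i + 1)) := by
    intro B _ p q h
    apply esymmAlgHom_injective (σ := Fin n) B (n := n) (by simp)
    apply Subtype.ext
    rw [esymmAlgHom_apply, esymmAlgHom_apply]
    exact h
  have h2 := (h1 ℤ).sumElim_comp (A := MvPolynomial (Fin n) (MvPolynomial (Fin n) ℤ))
    (h1 (MvPolynomial (Fin n) ℤ))
  have h3 := h2.map' (f := (sumAlgEquiv ℤ (Fin n) (Fin n)).symm.toAlgHom)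
    (sumAlgEquiv ℤ (Fin n) (Fin n)).symm.injective
  convert h3 using 1
  funext i
  apply (sumAlgEquiv ℤ (Fin n) (Fin n)).injective
  rcases i with i | i
  · simp [elemPair, esymm, map_sum, map_prod]
  · simp [elemPair, esymm, map_sum, map_prod, algebraMap_eq]

theorem exists_prodPoly (n : ℕ) : ∃ P : MvPolynomial (Fin n ⊕ Fin n) ℤ,
    aeval (elemPair n) P = prodTarget n := by
  classical
  let b : ℕ → MvPolynomial (Fin n) ℤ := fun k =>
    if k = 0 then 1 else if h : k - 1 < n then X ⟨k - 1, h⟩ else 0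
  let q : MvPolynomial (Fin n) (MvPolynomial (Fin n) ℤ) :=
    (∏ i, (∑ k ∈ Finset.range (n + 1), Polynomial.C (C (b k) * X i ^ k) * Polynomial.X ^ k :
      Polynomial (MvPolynomial (Fin n) (MvPolynomial (Fin n) ℤ)))).coeff n
  have hq : q.IsSymmetric := by
    intro e
    change (rename e).toRingHom q = q
    simp only [q]
    rw [← Polynomial.coeff_map, Polynomial.map_prod]
    congr 1
    refine Fintype.prod_equiv e _ _ fun i => ?_
    simp [Polynomial.map_sum]
  let β : MvPolynomial (Fin n) ℤ →+* MvPolynomial (Fin n ⊕ Fin n) ℤ :=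
    (aeval fun j : Fin n => rename Sum.inr (esymm (Fin n) ℤ (j + 1))).toRingHom
  let ψ : MvPolynomial (Fin n) (MvPolynomial (Fin n) ℤ) →+* MvPolynomial (Fin n ⊕ Fin n) ℤ :=
    eval₂Hom β fun i => X (Sum.inl i)
  obtain ⟨q', hq'⟩ := esymmAlgHom_surjective (σ := Fin n) (MvPolynomial (Fin n) ℤ) (n := n)
    (by simp) ⟨q, hq⟩
  have hq'' : aeval (fun i : Fin n => esymm (Fin n) (MvPolynomial (Fin n) ℤ) (i + 1)) q' = q := by
    rw [← esymmAlgHom_apply, hq']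
  have hcomm : ∀ p, aeval (elemPair n) ((sumAlgEquiv ℤ (Fin n) (Fin n)).symm p) =
      ψ (aeval (fun i : Fin n => esymm (Fin n) (MvPolynomial (Fin n) ℤ) (i + 1)) p) := by
    intro p
    have : ((aeval (elemPair n)).toRingHom.comp
        (sumAlgEquiv ℤ (Fin n) (Fin n)).symm.toRingEquiv.toRingHom) = ψ.comp
        (aeval (fun i : Fin n => esymm (Fin n) (MvPolynomial (Fin n) ℤ) (i + 1))).toRingHom := by
      apply MvPolynomial.ringHom_ext'
      · apply MvPolynomial.ringHom_ext'
        · exact RingHom.ext_int _ _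
        · intro j
          simp [ψ, β, elemPair]
      · intro i
        simp [ψ, elemPair, esymm, map_sum, map_prod]
    exact congrArg (fun f => f p) this
  refine ⟨(sumAlgEquiv ℤ (Fin n) (Fin n)).symm q', ?_⟩
  rw [hcomm, hq'', prodTarget, ← coeff_prod_one_add]
  simp only [q]
  rw [← Polynomial.coeff_map, Polynomial.map_prod, ← Finset.univ_product_univ, Finset.prod_product]
  congr 1
  refine Finset.prod_congr rfl fun i _ => ?_
  have h1 := prod_one_add_mul (Finset.univ : Finset (Fin n))
    (fun j => (Polynomial.C (X (Sum.inr j)) : Polynomial (MvPolynomial (Fin n ⊕ Fin n) ℤ)))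
    (Polynomial.C (X (Sum.inl i)) * Polynomial.X)
  have h2 : ∀ j : Fin n, (1 + Polynomial.C (X (Sum.inl i) * X (Sum.inr j)) * Polynomial.X :
      Polynomial (MvPolynomial (Fin n ⊕ Fin n) ℤ)) = 1 + Polynomial.C (X (Sum.inr j)) *
        (Polynomial.C (X (Sum.inl i)) * Polynomial.X) := by
    intro j; rw [map_mul]; ring
  simp only [h2]
  rw [h1, Polynomial.map_sum]
  simp only [Finset.card_univ, Fintype.card_fin]
  refine Finset.sum_congr rfl fun k hk => ?_
  have h3 : β (b k) = (Finset.univ.val.map fun j : Fin n =>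
      (X (Sum.inr j) : MvPolynomial (Fin n ⊕ Fin n) ℤ)).esymm k := by
    by_cases hk0 : k = 0
    · subst hk0; simp [b, Multiset.esymm]
    · have hk1 : k - 1 < n := by grind
      have hk2 : k - 1 + 1 = k := by omega
      rw [Finset.esymm_map_val]
      simp [b, hk0, hk1, β, hk2, esymm, map_sum, map_prod]
  have h4 : (Finset.univ.val.map fun j : Fin n =>
      (Polynomial.C (X (Sum.inr j)) : Polynomial (MvPolynomial (Fin n ⊕ Fin n) ℤ))).esymm k =
      Polynomial.C ((Finset.univ.val.map fun j : Fin n =>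
      (X (Sum.inr j) : MvPolynomial (Fin n ⊕ Fin n) ℤ)).esymm k) := by
    rw [Finset.esymm_map_val, Finset.esymm_map_val]
    simp [map_sum, map_prod]
  rw [h4, ← h3]
  simp [ψ]
  ring
/-- The universal polynomial `P_n` of the axiom for `λ^n(x y)`: it is the unique polynomial with
`P_n(e_1(x), …, e_n(x); e_1(y), …, e_n(y)) = e_n(x_i y_j : 1 ≤ i, j ≤ n)`
(see `aeval_prodPoly` and `prodPoly_unique`). -/
noncomputable def prodPoly (n : ℕ) : MvPolynomial (Fin n ⊕ Fin n) ℤ :=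
  Classical.choose (exists_prodPoly n)

theorem aeval_prodPoly (n : ℕ) : aeval (elemPair n) (prodPoly n) = prodTarget n :=
  Classical.choose_spec (exists_prodPoly n)

theorem prodPoly_unique (n : ℕ) (P : MvPolynomial (Fin n ⊕ Fin n) ℤ)
    (h : aeval (elemPair n) P = prodTarget n) : P = prodPoly n :=
  elemPair_algebraicIndependent n (h.trans (aeval_prodPoly n).symm)

/-- The `m`-th elementary symmetric polynomial of the `n`-fold products `x_{i_1} ⋯ x_{i_n}`,
`i_1 < ⋯ < i_n`, of `m * n` variables. -/
noncomputable def compTarget (m n : ℕ) : MvPolynomial (Fin (m * n)) ℤ :=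
  ((Finset.powersetCard n (Finset.univ : Finset (Fin (m * n)))).val.map
    (fun s => ∏ i ∈ s, X i)).esymm m

theorem compTarget_isSymmetric (m n : ℕ) : (compTarget m n).IsSymmetric := by
  classical
  intro e
  have h := coeff_prod_one_add (Finset.powersetCard n (Finset.univ : Finset (Fin (m * n))))
    (fun s => (∏ i ∈ s, X i : MvPolynomial (Fin (m * n)) ℤ)) m
  change (rename e).toRingHom (compTarget m n) = compTarget m n
  rw [compTarget, ← h, ← Polynomial.coeff_map, Polynomial.map_prod]
  congr 1
  refine Finset.prod_bij (fun s _ => s.map e.toEmbedding) ?_ ?_ ?_ ?_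
  · intro s hs
    simpa using hs
  · intro s _ t _ hst
    exact Finset.map_injective _ hst
  · intro t ht
    refine ⟨t.map e.symm.toEmbedding, by simpa using ht, ?_⟩
    ext i
    simp
  · intro s _
    have h1 : ∏ x ∈ s.map e.toEmbedding, (X x : MvPolynomial (Fin (m * n)) ℤ) =
        (rename e).toRingHom (∏ x ∈ s, X x) := by
      simp [map_prod]
    rw [h1]
    simp only [Polynomial.map_add, Polynomial.map_mul, Polynomial.map_one, Polynomial.map_C,
      Polynomial.map_X]

/-- The universal polynomial `P_{m,n}` of the axiom for `λ^m(λ^n(x))`: the expression of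
`compTarget m n` as a polynomial in the elementary symmetric polynomials `e_1, …, e_{mn}`. -/
noncomputable def compPoly (m n : ℕ) : MvPolynomial (Fin (m * n)) ℤ :=
  (esymmAlgEquiv (Fin (m * n)) ℤ (Fintype.card_fin (m * n))).symm
    ⟨compTarget m n, compTarget_isSymmetric m n⟩

theorem aeval_compPoly (m n : ℕ) :
    aeval (fun i : Fin (m * n) => esymm (Fin (m * n)) ℤ (i + 1)) (compPoly m n) =
      compTarget m n := by
  have h := (esymmAlgEquiv (Fin (m * n)) ℤ (Fintype.card_fin (m * n))).apply_symm_apply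
    ⟨compTarget m n, compTarget_isSymmetric m n⟩
  rw [← esymmAlgHom_apply, compPoly]
  exact congrArg Subtype.val h

end UniversalPolynomials

/-- A `λ`-ring (a *special* `λ`-ring in the older terminology). -/
class LambdaRing (R : Type*) [CommRing R] where
  /-- The operations `λ^n`. -/
  lam : ℕ → R → R
  lam_zero : ∀ x, lam 0 x = 1
  lam_one : ∀ x, lam 1 x = x
  lam_add : ∀ n x y, lam n (x + y) = ∑ p ∈ Finset.HasAntidiagonal.antidiagonal n, lam p.1 x * lam p.2 y
  lam_unit : ∀ n, 2 ≤ n → lam n 1 = 0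
  lam_mul : ∀ n x y, lam n (x * y) =
    aeval (Sum.elim (fun i : Fin n => lam (i + 1) x) (fun j : Fin n => lam (j + 1) y)) (prodPoly n)
  lam_lam : ∀ m n x, lam m (lam n x) =
    aeval (fun i : Fin (m * n) => lam (i + 1) x) (compPoly m n)

section SchurPolynomials

/-- The ring `Λ = ℤ[e_1, e_2, …]` of symmetric functions; the variable `X k` is `e_{k+1}`. -/
abbrev SymFun : Type := MvPolynomial ℕ ℤ

/-- The elementary symmetric function `e_n`, with `e_0 = 1`. -/
noncomputable def elemSym (n : ℕ) : SymFun := if n = 0 then 1 else X (n - 1)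

/-- The complete symmetric function `h_n`, given by `H(t) E(-t) = 1`. -/
noncomputable def completeSym (n : ℕ) : SymFun :=
  PowerSeries.coeff n (PowerSeries.invOfUnit (PowerSeries.mk fun k => (-1) ^ k * elemSym k) 1)

/-- `h_k` for an integer index `k`, with `h_k = 0` for `k < 0`. -/
noncomputable def completeSymInt (k : ℤ) : SymFun := if k < 0 then 0 else completeSym k.toNat

/-- The `N × N` matrix `(h_{r_i + j - i})`. -/
noncomputable def jt (N : ℕ) (r : ℕ → ℕ) : Matrix (Fin N) (Fin N) SymFun :=
  Matrix.of fun i j => completeSymInt ((r i : ℤ) + (j : ℤ) - (i : ℤ))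

/-- The Schur polynomial `s_μ = det (h_{μ_i + j - i})` in `Λ`. By `schur_alternant` below, it is the
symmetric function whose value in `N` variables is the quotient of alternants
`det (x_k^{μ_i + N - i}) / det (x_k^{N - i})`. -/
noncomputable def schur (μ : YoungDiagram) : SymFun := (jt (μ.colLen 0) μ.rowLen).det

/-- The map `Λ → ℤ[x_1, …, x_N]` sending `e_k` to the `k`-th elementary symmetric polynomial. -/
noncomputable def toVars (N : ℕ) : SymFun →ₐ[ℤ] MvPolynomial (Fin N) ℤ :=
  aeval fun k => esymm (Fin N) ℤ (k + 1)

theorem toVars_elemSym (N n : ℕ) : toVars N (elemSym n) = esymm (Fin N) ℤ n := by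
  rcases n with _ | n
  · simp [elemSym]
  · simp [elemSym, toVars]

theorem completeSym_zero : completeSym 0 = 1 := by
  simp [completeSym]

/-- The polynomial `∏_{i ∈ s} (1 - x_i t)`. -/
noncomputable def minusVars (N : ℕ) (s : Finset (Fin N)) :
    Polynomial (MvPolynomial (Fin N) ℤ) :=
  ∏ i ∈ s, (1 - Polynomial.C (X i) * Polynomial.X)

theorem hseries (N : ℕ) :
    (PowerSeries.mk fun n => toVars N (completeSym n)) *
      ((minusVars N Finset.univ : Polynomial (MvPolynomial (Fin N) ℤ)) :
        PowerSeries (MvPolynomial (Fin N) ℤ)) = 1 := by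
  have h1 : PowerSeries.mk (fun k => (-1) ^ k * elemSym k) * PowerSeries.mk completeSym = 1 := by
    have : PowerSeries.mk completeSym =
      PowerSeries.invOfUnit (PowerSeries.mk fun k => (-1) ^ k * elemSym k) 1 := by
      ext n : 1; simp [completeSym]
    rw [this]
    exact PowerSeries.mul_invOfUnit _ _ (by simp [elemSym])
  have h2 := congrArg (PowerSeries.map (toVars N).toRingHom) h1
  rw [map_mul, map_one, mul_comm] at h2
  convert h2 using 2
  · ext n : 1; simp
  · ext n : 1
    have h3 : minusVars N Finset.univ =
        ∏ i : Fin N, (1 + Polynomial.C (-X i : MvPolynomial (Fin N) ℤ) * Polynomial.X) := by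
      refine Finset.prod_congr rfl fun i _ => ?_
      rw [map_neg]; ring
    rw [Polynomial.coeff_coe, h3, coeff_prod_one_add]
    have h4 : (Finset.univ.val.map fun i : Fin N => -(X i : MvPolynomial (Fin N) ℤ)) =
        (Finset.univ.val.map fun i : Fin N => (X i : MvPolynomial (Fin N) ℤ)).map Neg.neg := by
      rw [Multiset.map_map]; rfl
    rw [h4, Multiset.esymm_neg, ← MvPolynomial.esymm_eq_multiset_esymm, ← toVars_elemSym]
    simp

theorem pow_eq (N : ℕ) (k : Fin N) (m : ℕ) :
    (X k : MvPolynomial (Fin N) ℤ) ^ m = ∑ j : Fin N,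
      toVars N (completeSymInt ((m : ℤ) - (N - 1 - j : ℤ))) *
        (minusVars N (Finset.univ.erase k)).coeff (N - 1 - j) := by
  set c := minusVars N (Finset.univ.erase k) with hc
  have hdeg : c.natDegree < N := by
    have h0 : c.natDegree ≤ ∑ i ∈ Finset.univ.erase k, 1 := by
      refine (Polynomial.natDegree_prod_le _ _).trans (Finset.sum_le_sum fun i _ => ?_)
      compute_degree
    have h1 : (Finset.univ.erase k).card < N := by
      have := Finset.card_erase_lt_of_mem (Finset.mem_univ k)
      simpa using this
    rw [Finset.sum_const, smul_eq_mul, mul_one] at h0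
    omega
  have h1 : (PowerSeries.mk fun n => toVars N (completeSym n)) *
      (c : PowerSeries (MvPolynomial (Fin N) ℤ)) = PowerSeries.mk fun n => X k ^ n := by
    have hg : (PowerSeries.mk fun n => (X k : MvPolynomial (Fin N) ℤ) ^ n) *
        (1 - PowerSeries.C (X k) * PowerSeries.X) = 1 := by
      ext n : 1
      rcases n with _ | n
      · simp [mul_sub, ← mul_assoc]
      · rw [mul_sub, ← mul_assoc, map_sub, PowerSeries.coeff_succ_mul_X, mul_one,
          PowerSeries.coeff_mul_C]
        simp [pow_succ, PowerSeries.coeff_one]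
    have hs := hseries N
    have hm : minusVars N Finset.univ = (1 - Polynomial.C (X k) * Polynomial.X) * c := by
      exact (Finset.mul_prod_erase Finset.univ
        (fun i => (1 - Polynomial.C (X i) * Polynomial.X :
          Polynomial (MvPolynomial (Fin N) ℤ))) (Finset.mem_univ k)).symm
    rw [hm] at hs
    push_cast at hs
    linear_combination (-(PowerSeries.mk fun n => toVars N (completeSym n)) *
      (c : PowerSeries (MvPolynomial (Fin N) ℤ))) * hg +
      (PowerSeries.mk fun n => (X k : MvPolynomial (Fin N) ℤ) ^ n) * hs
  have h2 := congrArg (PowerSeries.coeff m) h1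
  rw [PowerSeries.coeff_mk, PowerSeries.coeff_mul] at h2
  rw [← h2]
  simp only [PowerSeries.coeff_mk, Polynomial.coeff_coe]
  rw [Fin.sum_univ_eq_sum_range (fun j => toVars N (completeSymInt ((m : ℤ) - (N - 1 - j : ℤ))) *
    c.coeff (N - 1 - j)) N, ← Finset.sum_range_reflect, Finset.Nat.sum_antidiagonal_eq_sum_range_succ_mk,
    ← Finset.sum_range_reflect]
  have e1 : ∀ r ∈ Finset.range N, toVars N (completeSymInt ((m : ℤ) - (N - 1 - (N - 1 - r : ℕ) : ℤ)))
      * c.coeff (N - 1 - (N - 1 - r)) = toVars N (completeSymInt ((m : ℤ) - r)) * c.coeff r := by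
    intro r hr
    have := Finset.mem_range.1 hr
    have h5 : N - 1 - (N - 1 - r) = r := by omega
    have h6 : ((m : ℤ) - (N - 1 - (N - 1 - r : ℕ) : ℤ)) = m - r := by omega
    rw [h5, h6]
  have e2 : ∀ r ∈ Finset.range (m + 1), toVars N (completeSym (m + 1 - 1 - r)) *
      c.coeff (m - (m + 1 - 1 - r)) = toVars N (completeSymInt ((m : ℤ) - r)) * c.coeff r := by
    intro r hr
    have := Finset.mem_range.1 hr
    have h5 : m - (m + 1 - 1 - r) = r := by omega
    have h6 : ((m : ℤ) - r).toNat = m + 1 - 1 - r := by omega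
    rw [h5, completeSymInt, if_neg (by omega), h6]
  refine (Finset.sum_congr rfl e2).trans (Eq.trans ?_ (Finset.sum_congr rfl e1).symm)
  have z1 : ∀ r, m < r → toVars N (completeSymInt ((m : ℤ) - r)) * c.coeff r = 0 := by
    intro r hr
    rw [completeSymInt, if_pos (by omega), map_zero, zero_mul]
  have z2 : ∀ r, N ≤ r → toVars N (completeSymInt ((m : ℤ) - r)) * c.coeff r = 0 := by
    intro r hr
    rw [Polynomial.coeff_eq_zero_of_natDegree_lt (by omega), mul_zero]
  rcases le_total (m + 1) N with h | h
  · exact Finset.sum_subset (by intro x; simp; omega) fun r _ hr => z1 r (by simpa using hr)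
  · exact (Finset.sum_subset (by intro x; simp; omega) fun r _ hr => z2 r (by simpa using hr)).symm

theorem jt_alternant (N : ℕ) (r : ℕ → ℕ) :
    Matrix.det (Matrix.of fun i k : Fin N => (X k : MvPolynomial (Fin N) ℤ) ^ (r i + (N - 1 - i)))
     = toVars N (jt N r).det * Matrix.det (Matrix.of fun j k : Fin N =>
        (minusVars N (Finset.univ.erase k)).coeff (N - 1 - j)) := by
  rw [AlgHom.map_det, ← Matrix.det_mul]
  congr 1
  ext1 i k
  simp only [Matrix.of_apply, Matrix.mul_apply, AlgHom.mapMatrix_apply, Matrix.map_apply, jt]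
  rw [pow_eq]
  refine Finset.sum_congr rfl fun j _ => ?_
  congr 3
  have := i.2
  push_cast [Nat.sub_sub, show 1 + (i : ℕ) ≤ N by omega]
  ring

theorem jt_det_of_zero (N : ℕ) : (jt N fun _ => 0).det = 1 := by
  rw [Matrix.det_of_isUpperTriangular]
  · simp [jt, completeSymInt, completeSym_zero]
  · intro i j hij
    have : (j : ℕ) < i := hij
    simp [jt, completeSymInt]
    omega

theorem jt_det_stable (μ : YoungDiagram) (N : ℕ) (h : μ.colLen 0 ≤ N) :
    (jt N μ.rowLen).det = schur μ := by
  obtain ⟨d, rfl⟩ := Nat.exists_eq_add_of_le h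
  have hr : ∀ i, μ.colLen 0 ≤ i → μ.rowLen i = 0 := by
    intro i hi
    by_contra h0
    have h1 : (i, 0) ∈ μ := YoungDiagram.mem_iff_lt_rowLen.2 (Nat.pos_of_ne_zero h0)
    have := YoungDiagram.mem_iff_lt_colLen.1 h1
    omega
  rw [← Matrix.det_submatrix_equiv_self finSumFinEquiv, ← Matrix.fromBlocks_toBlocks
    ((jt (μ.colLen 0 + d) μ.rowLen).submatrix finSumFinEquiv finSumFinEquiv)]
  have h21 : ((jt (μ.colLen 0 + d) μ.rowLen).submatrix finSumFinEquiv
      finSumFinEquiv).toBlocks₂₁ = 0 := by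
    ext1 i j
    simp [Matrix.toBlocks₂₁, jt, completeSymInt, hr]
    omega
  have h22 : ((jt (μ.colLen 0 + d) μ.rowLen).submatrix finSumFinEquiv
      finSumFinEquiv).toBlocks₂₂ = jt d fun _ => 0 := by
    ext1 i j
    simp [Matrix.toBlocks₂₂, jt, hr]
  rw [h21, h22, Matrix.det_fromBlocks_zero₂₁, jt_det_of_zero, mul_one]
  rfl

/-- The bialternant formula `s_μ(x_1, …, x_N) = det (x_k^{μ_i + N - i}) / det (x_k^{N - i})`,
for every number `N` of variables not smaller than the number of rows of `μ`. -/
theorem schur_alternant (μ : YoungDiagram) (N : ℕ) (h : μ.colLen 0 ≤ N) :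
    toVars N (schur μ) *
      Matrix.det (Matrix.of fun i k : Fin N => (X k : MvPolynomial (Fin N) ℤ) ^ (N - 1 - i : ℕ)) =
    Matrix.det (Matrix.of fun i k : Fin N =>
      (X k : MvPolynomial (Fin N) ℤ) ^ (μ.rowLen i + (N - 1 - i))) := by
  have h0 := jt_alternant N fun _ => 0
  rw [jt_det_of_zero, map_one, one_mul] at h0
  simp only [zero_add] at h0
  rw [jt_alternant, jt_det_stable μ N h, h0]
end SchurPolynomials

section Elements

variable {R : Type*} [CommRing R] [LambdaRing R]

/-- The operation `f(x) = u_x(f)` of a symmetric function `f`, where `u_x : Λ → R` sends `e_n` to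
`λ^n(x)`. -/
noncomputable def symOp (f : SymFun) (x : R) : R :=
  aeval (fun k => LambdaRing.lam (k + 1) x) f

/-- `x` is Schur-finite if there is a partition `ν` such that `s_μ(x) = 0` for every partition `μ`
containing `ν`. -/
def IsSchurFinite (x : R) : Prop :=
  ∃ ν : YoungDiagram, ∀ μ : YoungDiagram, ν ≤ μ → symOp (schur μ) x = 0

/-- `x` is a line element if `λ^n(x) = 0` for all `n > 1`. -/
def IsLineElement (x : R) : Prop := ∀ n, 1 < n → LambdaRing.lam n x = 0

end Elements

/-- The underlying set of the big Witt ring `W(A)`: the power series over `A` with constant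
coefficient `1`. -/
def BigWitt (A : Type*) [CommRing A] : Type _ :=
  {f : PowerSeries A // PowerSeries.constantCoeff f = 1}

namespace BigWitt

variable {A : Type*} [CommRing A]

/-- The element `1 + ∑_{n ≥ 1} a_n t^n` of `W(A)`. -/
noncomputable def ofCoeffs (a : ℕ → A) : BigWitt A :=
  ⟨PowerSeries.mk fun n => if n = 0 then 1 else a n, by simp⟩

/-- The coefficient `a_n` of an element `1 + ∑_{n ≥ 1} a_n t^n` of `W(A)`. -/
noncomputable def coeff (n : ℕ) (f : BigWitt A) : A := PowerSeries.coeff n f.1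

/-- The zero of `W(A)` is the series `1`. -/
noncomputable def zero : BigWitt A := ⟨1, by simp⟩

/-- The unit of `W(A)` is the series `1 + t`. -/
noncomputable def one : BigWitt A := ⟨1 + PowerSeries.X, by simp⟩

/-- Addition in `W(A)` is multiplication of power series. -/
noncomputable def add (f g : BigWitt A) : BigWitt A := ⟨f.1 * g.1, by simp [f.2, g.2]⟩

/-- Multiplication in `W(A)`: the `n`-th coefficient is `P_n(a_1, …, a_n; b_1, …, b_n)`. It is
determined by `(1 + a t) * (1 + b t) = 1 + a b t`, functoriality, biadditivity and continuity. -/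
noncomputable def mul (f g : BigWitt A) : BigWitt A :=
  ofCoeffs fun n => aeval (Sum.elim (fun i : Fin n => f.coeff (i + 1))
    (fun j : Fin n => g.coeff (j + 1))) (prodPoly n)

/-- The operation `λ^m` on `W(A)`: the `n`-th coefficient is `P_{n,m}(a_1, …, a_{nm})`. -/
noncomputable def lam (m : ℕ) (f : BigWitt A) : BigWitt A :=
  ofCoeffs fun n => aeval (fun i : Fin (n * m) => f.coeff (i + 1)) (compPoly n m)

/-- The given ring structure and `λ`-structure on the set `W(A)` are those of the big Witt
ring. -/
structure IsStandard (A : Type*) [CommRing A] [CommRing (BigWitt A)]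
    [LambdaRing (BigWitt A)] : Prop where
  zero_eq : (0 : BigWitt A) = zero
  one_eq : (1 : BigWitt A) = one
  add_eq : ∀ f g : BigWitt A, f + g = add f g
  mul_eq : ∀ f g : BigWitt A, f * g = mul f g
  lam_eq : ∀ (m : ℕ) (f : BigWitt A), LambdaRing.lam m f = lam m f

end BigWitt

end LambdaTheory

/-!
Splitting principle: after an injective extension of the coefficients, finitely many elements of
`W(A)` agree up to any given order with products `∏ (1 + b t)`, that is, with sums of Teichmüller
elements. The Teichmüller map is multiplicative, so on such sums the addition, the multiplication
and `λ^n` of `W(A)` are computed by union, pairwise products and elementary symmetric functions of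
the multiset of the `b`. This reduces the `λ`-ring axioms of `W(A)` to the identities that define
`P_n` and `P_{m,n}`, extended from alphabets of the prescribed size to arbitrary finite multisets.

If `x` is Schur-finite with respect to `ν`, the Jacobi–Trudi formula says that the minors
`det (h_{k_i + j}(x))` with as many rows as `ν` vanish as soon as every `k_i` is at least the first
row of `ν`. The vectors `(h_k(x), …, h_{k + N - 1}(x))` therefore span a proper subspace, which is a
linear recurrence for `h_n(x)`. Hence `∑ h_n(x) t^n`, and with it `∑ λ^n(x) t^n`, is a quotient of
two polynomials, and over an algebraically closed field each of these is a product of factors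
`1 + a t`, which are line elements.
-/

namespace LambdaTheory

open MvPolynomial

section MultisetEsymm

variable {A B : Type*} [CommSemiring A] [CommSemiring B]

theorem multiset_esymm_zero (s : Multiset A) : s.esymm 0 = 1 := by
  simp [Multiset.esymm]

theorem esymm_cons_succ (a : A) (s : Multiset A) (n : ℕ) :
    (a ::ₘ s).esymm (n + 1) = s.esymm (n + 1) + a * s.esymm n := by
  simp [Multiset.esymm, Multiset.powersetCard_cons, Multiset.sum_map_mul_left]

theorem coeff_prod_map_one_add (s : Multiset A) (n : ℕ) :
    (s.map fun a => (1 + Polynomial.C a * Polynomial.X : Polynomial A)).prod.coeff n =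
      s.esymm n := by
  induction s using Multiset.induction_on generalizing n with
  | empty =>
    rcases n with _ | n
    · simp [multiset_esymm_zero]
    · simp [Multiset.esymm, Multiset.powersetCard_zero_right, Polynomial.coeff_one]
  | cons a s ih =>
    rw [Multiset.map_cons, Multiset.prod_cons, add_mul, one_mul, Polynomial.coeff_add, ih,
      mul_assoc, Polynomial.coeff_C_mul]
    rcases n with _ | n
    · simp [multiset_esymm_zero]
    · rw [Polynomial.coeff_X_mul, ih, esymm_cons_succ]

theorem esymm_add (s t : Multiset A) (n : ℕ) :
    (s + t).esymm n = ∑ p ∈ Finset.HasAntidiagonal.antidiagonal n, s.esymm p.1 * t.esymm p.2 := by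
  simp only [← coeff_prod_map_one_add, Multiset.map_add, Multiset.prod_add, Polynomial.coeff_mul]

theorem esymm_map_ringHom (φ : A →+* B) (s : Multiset A) (n : ℕ) :
    (s.map φ).esymm n = φ (s.esymm n) := by
  simp only [Multiset.esymm, Multiset.powersetCard_map, map_multiset_sum, Multiset.map_map,
    Function.comp_def, map_multiset_prod]

theorem esymm_map_mul_left (a : A) (s : Multiset A) (n : ℕ) :
    (s.map (a * ·)).esymm n = a ^ n * s.esymm n := by
  simpa using (Multiset.pow_smul_esymm a n s).symm

theorem esymm_add_replicate_zero (s : Multiset A) (d n : ℕ) :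
    (s + Multiset.replicate d 0).esymm n = s.esymm n := by
  induction d with
  | zero => simp
  | succ d ih =>
    rw [Multiset.replicate_succ, Multiset.add_cons]
    rcases n with _ | n
    · simp [multiset_esymm_zero]
    · rw [esymm_cons_succ, zero_mul, add_zero, ih]

theorem exists_univ_map_eq {α : Type*} {s : Multiset α} {n : ℕ} (h : s.card = n) :
    ∃ x : Fin n → α, Finset.univ.val.map x = s := by
  subst h
  induction s using Quotient.inductionOn with
  | h l => exact ⟨l.get, (Fin.univ_val_map l.get).trans (congrArg _ (List.ofFn_get l))⟩

end MultisetEsymm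

section ProductMultisets

section Monoid

variable {M N : Type*} [CommMonoid M] [CommMonoid N]

/-- The multiset of the products of `n` members of `s`. -/
def subsetProds (n : ℕ) (s : Multiset M) : Multiset M := (s.powersetCard n).map Multiset.prod

/-- The multiset of the products of a member of `s` and a member of `t`. -/
def pairProds (s t : Multiset M) : Multiset M := (s ×ˢ t).map fun p => p.1 * p.2

theorem subsetProds_map {F : Type*} [FunLike F M N] [MonoidHomClass F M N] (φ : F) (n : ℕ)
    (s : Multiset M) : subsetProds n (s.map φ) = (subsetProds n s).map φ := by
  simp only [subsetProds, Multiset.powersetCard_map, Multiset.map_map, Function.comp_def,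
    map_multiset_prod]

theorem subsetProds_map_mul_left (a : M) (n : ℕ) (s : Multiset M) :
    subsetProds n (s.map (a * ·)) = (subsetProds n s).map (a ^ n * ·) := by
  simp only [subsetProds, Multiset.powersetCard_map, Multiset.map_map, Function.comp_def]
  refine Multiset.map_congr rfl fun u hu => ?_
  rw [Multiset.prod_map_mul, Multiset.map_const', Multiset.prod_replicate,
    (Multiset.mem_powersetCard.1 hu).2, Multiset.map_id']

theorem subsetProds_succ_cons (a : M) (n : ℕ) (s : Multiset M) :
    subsetProds (n + 1) (a ::ₘ s) = subsetProds (n + 1) s + (subsetProds n s).map (a * ·) := by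
  simp [subsetProds, Multiset.powersetCard_cons]

theorem pairProds_zero (t : Multiset M) : pairProds 0 t = 0 := by
  simp [pairProds]

theorem pairProds_cons (a : M) (s t : Multiset M) :
    pairProds (a ::ₘ s) t = t.map (a * ·) + pairProds s t := by
  simp [pairProds, Multiset.cons_product]

theorem pairProds_map {F : Type*} [FunLike F M N] [MonoidHomClass F M N] (φ : F)
    (s t : Multiset M) : pairProds (s.map φ) (t.map φ) = (pairProds s t).map φ := by
  induction s using Multiset.induction_on with
  | empty => simp [pairProds_zero]
  | cons a s ih => simp [pairProds_cons, ih]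

theorem pairProds_comm (s t : Multiset M) : pairProds s t = pairProds t s := by
  rw [pairProds, pairProds, ← Multiset.map_swap_product, Multiset.map_map]
  simp [mul_comm]

theorem pairProds_add (s s' t : Multiset M) :
    pairProds (s + s') t = pairProds s t + pairProds s' t := by
  simp [pairProds, Multiset.add_product]

theorem pairProds_map_mul_left (a : M) (s t : Multiset M) :
    pairProds (s.map (a * ·)) t = (pairProds s t).map (a * ·) := by
  induction s using Multiset.induction_on with
  | empty => simp [pairProds_zero]
  | cons b s ih => simp [pairProds_cons, ih, mul_assoc]

theorem pairProds_assoc (s t u : Multiset M) :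
    pairProds (pairProds s t) u = pairProds s (pairProds t u) := by
  induction s using Multiset.induction_on with
  | empty => simp [pairProds_zero]
  | cons a s ih => rw [pairProds_cons, pairProds_cons, pairProds_add, ih, pairProds_map_mul_left]

theorem pairProds_univ_map {ι κ : Type*} [Fintype ι] [Fintype κ] (x : ι → M) (y : κ → M) :
    pairProds (Finset.univ.val.map x) (Finset.univ.val.map y) =
      (Finset.univ : Finset (ι × κ)).val.map fun p => x p.1 * y p.2 := by
  rw [← Finset.univ_product_univ, Finset.product_val]
  simp [pairProds, SProd.sprod, Multiset.product, Multiset.map_bind, Multiset.bind_map]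

theorem subsetProds_univ_map {ι : Type*} [Fintype ι] (n : ℕ) (x : ι → M) :
    subsetProds n (Finset.univ.val.map x) =
      (Finset.powersetCard n Finset.univ).val.map fun u => ∏ i ∈ u, x i := by
  rw [subsetProds, Multiset.powersetCard_map, ← Finset.map_val_val_powersetCard]
  simp only [Multiset.map_map, Function.comp_def]
  rfl

end Monoid

variable {A B : Type*} [CommSemiring A] [CommSemiring B]

theorem esymm_pairProds_map (φ : A →+* B) (s t : Multiset A) (n : ℕ) :
    (pairProds (s.map φ) (t.map φ)).esymm n = φ ((pairProds s t).esymm n) := by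
  rw [pairProds_map, esymm_map_ringHom]

theorem esymm_subsetProds_map (φ : A →+* B) (s : Multiset A) (m n : ℕ) :
    (subsetProds n (s.map φ)).esymm m = φ ((subsetProds n s).esymm m) := by
  rw [subsetProds_map, esymm_map_ringHom]

theorem esymm_subsetProds_add_replicate_zero (s : Multiset A) (d m n : ℕ) :
    (subsetProds n (s + Multiset.replicate d 0)).esymm m = (subsetProds n s).esymm m := by
  induction d with
  | zero => simp
  | succ d ih =>
    rw [Multiset.replicate_succ, Multiset.add_cons]
    rcases n with _ | n
    · simp [subsetProds]
    · simp only [subsetProds_succ_cons, zero_mul, Multiset.map_const', esymm_add_replicate_zero,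
        ih]

theorem esymm_pairProds_congr {N : ℕ} {s s' t t' : Multiset A}
    (hs : ∀ k ≤ N, s.esymm k = s'.esymm k) (ht : ∀ k ≤ N, t.esymm k = t'.esymm k) :
    ∀ k ≤ N, (pairProds s t).esymm k = (pairProds s' t').esymm k := by
  have congr_right (s : Multiset A) {t t' : Multiset A}
      (h : ∀ k ≤ N, t.esymm k = t'.esymm k) :
      ∀ k ≤ N, (pairProds s t).esymm k = (pairProds s t').esymm k := by
    induction s using Multiset.induction_on with
    | empty => simp [pairProds_zero]
    | cons a s ih =>
      intro k hk
      rw [pairProds_cons, pairProds_cons, esymm_add, esymm_add]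
      refine Finset.sum_congr rfl fun p hp => ?_
      have := Finset.HasAntidiagonal.mem_antidiagonal.1 hp
      rw [esymm_map_mul_left, esymm_map_mul_left, h _ (by omega), ih _ (by omega)]
  intro k hk
  rw [congr_right s ht k hk, pairProds_comm, congr_right t' hs k hk, pairProds_comm]

end ProductMultisets

section UniversalPolynomialsAtMultisets

variable {A B : Type*} [CommRing A] [CommRing B]

theorem map_aeval_int [Algebra ℤ A] [Algebra ℤ B] {σ : Type*} (φ : A →+* B) (u : σ → A)
    (p : MvPolynomial σ ℤ) : φ (aeval u p) = aeval (fun i => φ (u i)) p :=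
  comp_aeval_apply u { φ with commutes' := by simp : A →ₐ[ℤ] B } p

theorem aeval_sub_aeval_mem [Algebra ℤ A] (I : Ideal A) {σ : Type*} {u v : σ → A}
    (h : ∀ i, u i - v i ∈ I) (p : MvPolynomial σ ℤ) : aeval u p - aeval v p ∈ I := by
  rw [← Ideal.Quotient.eq, map_aeval_int, map_aeval_int]
  congr 2
  exact funext fun i => Ideal.Quotient.eq.2 (h i)

theorem aeval_aeval_esymm [Algebra ℤ A] {n : ℕ} (x : Fin n → A) (Q : MvPolynomial (Fin n) ℤ) :
    aeval x (aeval (fun i : Fin n => esymm (Fin n) ℤ (i + 1)) Q) =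
      aeval (fun i : Fin n => (Finset.univ.val.map x).esymm (i + 1)) Q := by
  rw [← AlgHom.coe_toRingHom, map_aeval_int]
  simp [aeval_esymm_eq_multiset_esymm]

theorem aeval_esymm_subsetProds_X [Algebra ℤ A] {r : ℕ} (x : Fin r → A) (m n : ℕ) :
    aeval x ((subsetProds n (Finset.univ.val.map X)).esymm m : MvPolynomial (Fin r) ℤ) =
      (subsetProds n (Finset.univ.val.map x)).esymm m := by
  rw [← AlgHom.coe_toRingHom, ← esymm_subsetProds_map, Multiset.map_map]
  simp [Function.comp_def]

theorem isSymmetric_esymm_subsetProds_X (m n r : ℕ) :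
    ((subsetProds n (Finset.univ.val.map X)).esymm m : MvPolynomial (Fin r) ℤ).IsSymmetric := by
  intro e
  rw [rename_eq_aeval, aeval_esymm_subsetProds_X, ← Multiset.map_map, Multiset.map_univ_val_equiv]

theorem exists_esymm_subsetProds_eq_aeval [Algebra ℤ A] (m n r : ℕ) :
    ∃ Q : MvPolynomial (Fin r) ℤ, ∀ s : Multiset A, s.card = r →
      (subsetProds n s).esymm m = aeval (fun i : Fin r => s.esymm (i + 1)) Q := by
  obtain ⟨Q, hQ⟩ := esymmAlgHom_surjective (σ := Fin r) ℤ (n := r) (by simp)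
    ⟨_, isSymmetric_esymm_subsetProds_X m n r⟩
  refine ⟨Q, fun s hs => ?_⟩
  obtain ⟨x, rfl⟩ := exists_univ_map_eq hs
  rw [← aeval_esymm_subsetProds_X, ← aeval_aeval_esymm, ← esymmAlgHom_apply, hQ]

theorem esymm_subsetProds_congr {m n : ℕ} {s s' : Multiset A} (hcard : s.card = s'.card)
    (h : ∀ k ≤ m * n, s.esymm k = s'.esymm k) :
    (subsetProds n s).esymm m = (subsetProds n s').esymm m := by
  obtain ⟨Q, hQ⟩ := exists_esymm_subsetProds_eq_aeval (A := Polynomial A) m n s.card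
  -- Scaling the elements by `X` turns weights into degrees: `e_m` of the `n`-fold products is then
  -- the coefficient of `X ^ (m * n)`.
  let scale (u : Multiset A) : Multiset (Polynomial A) :=
    (u.map Polynomial.C).map (Polynomial.X * ·)
  have esymm_scale (u : Multiset A) (k : ℕ) :
      (scale u).esymm k = Polynomial.X ^ k * Polynomial.C (u.esymm k) := by
    rw [esymm_map_mul_left, esymm_map_ringHom]
  have coeff_scale (u : Multiset A) :
      ((subsetProds n (scale u)).esymm m).coeff (m * n) = (subsetProds n u).esymm m := by
    rw [subsetProds_map_mul_left, esymm_map_mul_left, esymm_subsetProds_map, ← pow_mul,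
      mul_comm n m, Polynomial.coeff_X_pow_mul', if_pos le_rfl, Nat.sub_self,
      Polynomial.coeff_C_zero]
  have hmem := aeval_sub_aeval_mem (Ideal.span {(Polynomial.X : Polynomial A) ^ (m * n + 1)})
    (u := fun i : Fin s.card => (scale s).esymm (i + 1))
    (v := fun i : Fin s.card => (scale s').esymm (i + 1)) (fun i => by
      rw [esymm_scale, esymm_scale]
      rcases le_or_gt (i + 1 : ℕ) (m * n) with hi | hi
      · rw [h _ hi, sub_self]
        exact Ideal.zero_mem _
      · rw [← mul_sub]
        exact Ideal.mul_mem_right _ _ (Ideal.mem_span_singleton.2 (pow_dvd_pow _ hi))) Q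
  rw [← hQ _ (by simp [scale]), ← hQ _ (by simp [scale, hcard]),
    Ideal.mem_span_singleton, Polynomial.X_pow_dvd_iff] at hmem
  rw [← coeff_scale, ← coeff_scale, ← sub_eq_zero, ← Polynomial.coeff_sub]
  exact hmem _ (Nat.lt_succ_self _)

theorem aeval_esymm_prodPoly_of_card {s t : Multiset A} {n : ℕ} (hs : s.card = n)
    (ht : t.card = n) :
    aeval (Sum.elim (fun i : Fin n => s.esymm (i + 1)) (fun j : Fin n => t.esymm (j + 1)))
      (prodPoly n) = (pairProds s t).esymm n := by
  obtain ⟨x, rfl⟩ := exists_univ_map_eq hs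
  obtain ⟨y, rfl⟩ := exists_univ_map_eq ht
  have h := congrArg (aeval (Sum.elim x y)).toRingHom (aeval_prodPoly n)
  rw [map_aeval_int, prodTarget, ← esymm_map_ringHom] at h
  convert h using 2
  · congr 1
    ext i
    rcases i with i | i <;> simp [elemPair, aeval_rename, aeval_esymm_eq_multiset_esymm]
  · rw [pairProds_univ_map, Multiset.map_map]
    simp

theorem aeval_esymm_compPoly_of_card {s : Multiset A} {m n : ℕ} (hs : s.card = m * n) :
    aeval (fun i : Fin (m * n) => s.esymm (i + 1)) (compPoly m n) =
      (subsetProds n s).esymm m := by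
  obtain ⟨x, rfl⟩ := exists_univ_map_eq hs
  rw [← aeval_aeval_esymm, aeval_compPoly, compTarget, ← subsetProds_univ_map,
    aeval_esymm_subsetProds_X]

end UniversalPolynomialsAtMultisets

section Splitting

theorem exists_multiset_esymm_eq_of_splits {A : Type*} [CommRing A] [Nontrivial A]
    {p : Polynomial A} (hp : p.Splits) (hmonic : p.Monic) :
    ∃ s : Multiset A, s.card = p.natDegree ∧
      ∀ k ≤ p.natDegree, s.esymm k = p.coeff (p.natDegree - k) := by
  obtain ⟨s, hs⟩ := Polynomial.splits_iff_exists_multiset'.1 hp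
  rw [hmonic.leadingCoeff, map_one, one_mul] at hs
  have hcard : s.card = p.natDegree := by
    rw [hs, Polynomial.natDegree_multiset_prod_of_monic _ (by simp [Polynomial.monic_X_add_C])]
    simp
  refine ⟨s, hcard, fun k hk => ?_⟩
  rw [← hcard] at hk ⊢
  rw [hs, Multiset.prod_X_add_C_coeff s (Nat.sub_le _ _), Nat.sub_sub_self hk]

theorem exists_monic_coeff_sub_eq {A : Type*} [CommSemiring A] [Nontrivial A] {c : ℕ → A}
    (hc : c 0 = 1) (N : ℕ) :
    ∃ p : Polynomial A, p.Monic ∧ p.natDegree = N ∧ ∀ k ≤ N, p.coeff (N - k) = c k := by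
  let p : Polynomial A := PowerSeries.trunc (N + 1) (PowerSeries.mk fun k => c (N - k))
  have hcoeff : ∀ k ≤ N, p.coeff (N - k) = c k := by
    intro k hk
    rw [PowerSeries.coeff_trunc, if_pos (by omega), PowerSeries.coeff_mk, Nat.sub_sub_self hk]
  have hlead : p.coeff N = 1 := (hcoeff 0 N.zero_le).trans hc
  have hdeg : p.natDegree ≤ N := Nat.lt_succ_iff.1 (PowerSeries.natDegree_trunc_lt _ _)
  exact ⟨p, Polynomial.monic_of_natDegree_le_of_coeff_eq_one N hdeg hlead,
    hdeg.antisymm (Polynomial.le_natDegree_of_ne_zero (by simp [hlead])), hcoeff⟩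

theorem exists_multiset_esymm_eq_coeff {E : Type*} [Field E] [IsAlgClosed E] {p : Polynomial E}
    (hp : p.coeff 0 = 1) : ∃ s : Multiset E, ∀ n, s.esymm n = p.coeff n := by
  obtain ⟨q, hq, hdeg, hcoeff⟩ := exists_monic_coeff_sub_eq hp p.natDegree
  obtain ⟨s, hcard, hs⟩ := exists_multiset_esymm_eq_of_splits (IsAlgClosed.splits q) hq
  rw [hdeg] at hcard hs
  refine ⟨s, fun n => ?_⟩
  rcases le_or_gt n p.natDegree with hn | hn
  · rw [hs n hn, hcoeff n hn]
  · rw [esymm_eq_zero_of_card_lt _ _ (hcard ▸ hn), Polynomial.coeff_eq_zero_of_natDegree_lt hn]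

universe u

theorem exists_extension_multiset_esymm_eq {A : Type u} [CommRing A] {c : ℕ → A} (hc : c 0 = 1)
    (N : ℕ) :
    ∃ (B : Type u) (_ : CommRing B) (φ : A →+* B) (s : Multiset B), Function.Injective φ ∧
      s.card = N ∧ ∀ k ≤ N, s.esymm k = φ (c k) := by
  cases subsingleton_or_nontrivial A
  · exact ⟨A, inferInstance, RingHom.id A, Multiset.replicate N 0, Function.injective_id,
      Multiset.card_replicate _ _, fun _ _ => Subsingleton.elim _ _⟩
  obtain ⟨p, hp, hdeg, hcoeff⟩ := exists_monic_coeff_sub_eq hc N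
  obtain ⟨B, _, _, _, _, _, hsplits⟩ := hp.exists_splits_map
  obtain ⟨s, hcard, hs⟩ := exists_multiset_esymm_eq_of_splits hsplits (hp.map _)
  rw [hp.natDegree_map, hdeg] at hcard hs
  refine ⟨B, inferInstance, algebraMap A B, s, FaithfulSMul.algebraMap_injective A B, hcard,
    fun k hk => ?_⟩
  rw [hs k hk, Polynomial.coeff_map, hcoeff k hk]

theorem exists_extension_forall_multiset_esymm_eq (N : ℕ) {r : ℕ} {A : Type u} [CommRing A]
    {c : Fin r → ℕ → A} (hc : ∀ i, c i 0 = 1) :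
    ∃ (B : Type u) (_ : CommRing B) (φ : A →+* B) (s : Fin r → Multiset B), Function.Injective φ ∧
      ∀ i, (s i).card = N ∧ ∀ k ≤ N, (s i).esymm k = φ (c i k) := by
  induction r generalizing A with
  | zero => exact ⟨A, inferInstance, RingHom.id A, Fin.elim0, Function.injective_id, Fin.rec0⟩
  | succ r ih =>
    obtain ⟨B, _, φ, s₀, hφ, hcard₀, hs₀⟩ := exists_extension_multiset_esymm_eq (hc 0) N
    obtain ⟨B', _, φ', s, hφ', hs⟩ :=
      ih (A := B) (c := fun i k => φ (c i.succ k)) fun i => by rw [hc, map_one]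
    refine ⟨B', inferInstance, φ'.comp φ, Fin.cons (s₀.map φ') s, hφ'.comp hφ,
      Fin.cases ⟨by simpa using hcard₀, fun k hk => ?_⟩ hs⟩
    rw [Fin.cons_zero, esymm_map_ringHom, hs₀ k hk, RingHom.comp_apply]

end Splitting

section UniversalPolynomialsAtArbitraryMultisets

variable {A : Type*} [CommRing A]

theorem aeval_esymm_prodPoly (s t : Multiset A) (n : ℕ) :
    aeval (Sum.elim (fun i : Fin n => s.esymm (i + 1)) (fun j : Fin n => t.esymm (j + 1)))
      (prodPoly n) = (pairProds s t).esymm n := by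
  obtain ⟨B, _, φ, u, hφ, hu⟩ := exists_extension_forall_multiset_esymm_eq n
    (c := ![s.esymm, t.esymm]) (by simp [Fin.forall_fin_two, multiset_esymm_zero])
  obtain ⟨⟨hs, hs'⟩, ht, ht'⟩ := Fin.forall_fin_two.1 hu
  apply hφ
  rw [← esymm_pairProds_map, map_aeval_int]
  rw [← esymm_pairProds_congr (fun k hk => (hs' k hk).trans (esymm_map_ringHom φ s k).symm)
    (fun k hk => (ht' k hk).trans (esymm_map_ringHom φ t k).symm) n le_rfl,
    ← aeval_esymm_prodPoly_of_card hs ht]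
  congr 2
  ext i
  rcases i with i | i
  · exact (hs' _ i.2).symm
  · exact (ht' _ i.2).symm

theorem aeval_esymm_compPoly (s : Multiset A) (m n : ℕ) :
    aeval (fun i : Fin (m * n) => s.esymm (i + 1)) (compPoly m n) =
      (subsetProds n s).esymm m := by
  obtain ⟨B, _, φ, u, hφ, hcard, hu⟩ :=
    exists_extension_multiset_esymm_eq (multiset_esymm_zero s) (m * n)
  apply hφ
  calc φ (aeval (fun i : Fin (m * n) => s.esymm (i + 1)) (compPoly m n))
      = aeval (fun i : Fin (m * n) => u.esymm (i + 1)) (compPoly m n) := by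
        rw [map_aeval_int]
        congr 2
        exact funext fun i => (hu _ i.2).symm
    _ = (subsetProds n u).esymm m := aeval_esymm_compPoly_of_card hcard
    _ = (subsetProds n (u + Multiset.replicate s.card 0)).esymm m :=
        (esymm_subsetProds_add_replicate_zero u _ m n).symm
    _ = (subsetProds n (s.map φ + Multiset.replicate (m * n) 0)).esymm m := by
        refine esymm_subsetProds_congr (by simp [hcard, add_comm]) fun k hk => ?_
        rw [esymm_add_replicate_zero, esymm_add_replicate_zero, hu k hk, esymm_map_ringHom]
    _ = φ ((subsetProds n s).esymm m) := by
        rw [esymm_subsetProds_add_replicate_zero, esymm_subsetProds_map]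

end UniversalPolynomialsAtArbitraryMultisets

namespace BigWitt

section Coefficients

variable {A : Type*} [CommRing A]

theorem ext_coeff {f g : BigWitt A} (h : ∀ n, f.coeff n = g.coeff n) : f = g :=
  Subtype.ext (PowerSeries.ext h)

theorem coeff_zero (f : BigWitt A) : f.coeff 0 = 1 := by
  simpa [coeff] using f.2

theorem coeff_ofCoeffs {a : ℕ → A} (ha : a 0 = 1) (n : ℕ) : (ofCoeffs a).coeff n = a n := by
  simp only [coeff, ofCoeffs, PowerSeries.coeff_mk, ite_eq_right_iff]
  exact fun hn => hn ▸ ha.symm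

noncomputable instance : Zero (BigWitt A) := ⟨zero⟩

noncomputable instance : One (BigWitt A) := ⟨one⟩

noncomputable instance : Add (BigWitt A) := ⟨add⟩

noncomputable instance : Mul (BigWitt A) := ⟨mul⟩

noncomputable instance : Neg (BigWitt A) := ⟨fun f => ⟨PowerSeries.invOfUnit f.1 1, by simp⟩⟩

theorem coeff_add (f g : BigWitt A) (n : ℕ) :
    (f + g).coeff n = ∑ p ∈ Finset.HasAntidiagonal.antidiagonal n, f.coeff p.1 * g.coeff p.2 :=
  PowerSeries.coeff_mul n f.1 g.1

theorem coeff_mul (f g : BigWitt A) (n : ℕ) :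
    (f * g).coeff n = aeval (Sum.elim (fun i : Fin n => f.coeff (i + 1))
      (fun j : Fin n => g.coeff (j + 1))) (prodPoly n) := by
  refine coeff_ofCoeffs ?_ n
  rw [← multiset_esymm_zero (pairProds (0 : Multiset A) 0), ← aeval_esymm_prodPoly]
  exact congrArg (aeval · (prodPoly 0)) (Subsingleton.elim _ _)

theorem coeff_lam (m : ℕ) (f : BigWitt A) (n : ℕ) :
    (lam m f).coeff n = aeval (fun i : Fin (n * m) => f.coeff (i + 1)) (compPoly n m) := by
  refine coeff_ofCoeffs ?_ n
  have : IsEmpty (Fin (0 * m)) := by rw [zero_mul]; infer_instance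
  rw [← multiset_esymm_zero (subsetProds m (0 : Multiset A)), ← aeval_esymm_compPoly]
  exact congrArg (aeval · (compPoly 0 m)) (Subsingleton.elim _ _)

/-- The series `∏ (1 + a t)`, `a ∈ s`, as an element of `W(A)`. -/
noncomputable def ofRoots (s : Multiset A) : BigWitt A :=
  ⟨((s.map fun a => (1 + Polynomial.C a * Polynomial.X : Polynomial A)).prod : Polynomial A), by
    rw [← PowerSeries.coeff_zero_eq_constantCoeff_apply, Polynomial.coeff_coe,
      coeff_prod_map_one_add, multiset_esymm_zero]⟩

theorem coeff_ofRoots (s : Multiset A) (n : ℕ) : (ofRoots s).coeff n = s.esymm n :=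
  (Polynomial.coeff_coe _ n).trans (coeff_prod_map_one_add s n)

theorem ofRoots_zero : ofRoots (0 : Multiset A) = 0 :=
  Subtype.ext Polynomial.coe_one

theorem ofRoots_singleton_one : ofRoots ({1} : Multiset A) = 1 :=
  Subtype.ext (by simp [ofRoots]; rfl)

theorem ofRoots_add (s t : Multiset A) : ofRoots (s + t) = ofRoots s + ofRoots t :=
  ext_coeff fun n => by simp only [coeff_ofRoots, coeff_add, esymm_add]

theorem ofRoots_pairProds (s t : Multiset A) : ofRoots (pairProds s t) = ofRoots s * ofRoots t :=
  ext_coeff fun n => by simp only [coeff_ofRoots, coeff_mul, aeval_esymm_prodPoly]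

theorem lam_ofRoots (m : ℕ) (s : Multiset A) : lam m (ofRoots s) = ofRoots (subsetProds m s) :=
  ext_coeff fun n => by simp only [coeff_ofRoots, coeff_lam, aeval_esymm_compPoly]

end Coefficients

section Splitting

variable {A B : Type*} [CommRing A] [CommRing B] {φ : A →+* B} {N : ℕ} {f g : BigWitt A}
  {s t : Multiset B}

/-- Over `B`, the series `f` agrees with `∏ (1 + b t)`, `b ∈ s`, modulo `t ^ (N + 1)`: the members
of `s` are approximate Chern roots of `f`. -/
def SplitsUpTo (N : ℕ) (φ : A →+* B) (f : BigWitt A) (s : Multiset B) : Prop :=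
  ∀ k ≤ N, φ (f.coeff k) = s.esymm k

theorem SplitsUpTo.mono {M : ℕ} (h : SplitsUpTo N φ f s) (hMN : M ≤ N) : SplitsUpTo M φ f s :=
  fun k hk => h k (hk.trans hMN)

theorem SplitsUpTo.coeff_eq (hf : SplitsUpTo N φ f s) (hg : SplitsUpTo N φ g s)
    (hφ : Function.Injective φ) : f.coeff N = g.coeff N :=
  hφ ((hf N le_rfl).trans (hg N le_rfl).symm)

theorem SplitsUpTo.add (hf : SplitsUpTo N φ f s) (hg : SplitsUpTo N φ g t) :
    SplitsUpTo N φ (f + g) (s + t) := by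
  intro k hk
  rw [coeff_add, map_sum, esymm_add]
  refine Finset.sum_congr rfl fun p hp => ?_
  have := Finset.HasAntidiagonal.mem_antidiagonal.1 hp
  rw [map_mul, hf _ (by omega), hg _ (by omega)]

theorem SplitsUpTo.mul (hf : SplitsUpTo N φ f s) (hg : SplitsUpTo N φ g t) :
    SplitsUpTo N φ (f * g) (pairProds s t) := by
  intro k hk
  rw [coeff_mul, map_aeval_int, ← aeval_esymm_prodPoly]
  congr 2
  ext i
  rcases i with i | i
  · exact hf _ (i.2.trans_le hk)
  · exact hg _ (i.2.trans_le hk)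

theorem SplitsUpTo.lam {m : ℕ} (hf : SplitsUpTo (N * m) φ f s) :
    SplitsUpTo N φ (lam m f) (subsetProds m s) := by
  intro k hk
  rw [coeff_lam, map_aeval_int, ← aeval_esymm_compPoly]
  congr 2
  exact funext fun i => hf _ (i.2.trans_le (Nat.mul_le_mul_right _ hk))

universe u

theorem exists_splitsUpTo {A : Type u} [CommRing A] {r : ℕ} (f : Fin r → BigWitt A) (N : ℕ) :
    ∃ (B : Type u) (_ : CommRing B) (φ : A →+* B) (s : Fin r → Multiset B), Function.Injective φ ∧
      ∀ i, SplitsUpTo N φ (f i) (s i) := by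
  obtain ⟨B, _, φ, s, hφ, hs⟩ :=
    exists_extension_forall_multiset_esymm_eq N (c := fun i k => (f i).coeff k) fun i =>
      (f i).coeff_zero
  exact ⟨B, inferInstance, φ, s, hφ, fun i k hk => ((hs i).2 k hk).symm⟩

end Splitting

section Ring

variable {A B : Type*} [CommRing A] [CommRing B]

theorem splitsUpTo_ofRoots (N : ℕ) (φ : A →+* B) (s : Multiset A) :
    SplitsUpTo N φ (ofRoots s) (s.map φ) := fun k _ => by
  rw [coeff_ofRoots, esymm_map_ringHom]

protected theorem mul_comm (f g : BigWitt A) : f * g = g * f := by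
  refine ext_coeff fun N => ?_
  obtain ⟨B, _, φ, s, hφ, hs⟩ := exists_splitsUpTo ![f, g] N
  obtain ⟨hf, hg⟩ := Fin.forall_fin_two.1 hs
  exact (hf.mul hg).coeff_eq (pairProds_comm (s 1) (s 0) ▸ hg.mul hf) hφ

protected theorem mul_assoc (f g h : BigWitt A) : f * g * h = f * (g * h) := by
  refine ext_coeff fun N => ?_
  obtain ⟨B, _, φ, s, hφ, hs⟩ := exists_splitsUpTo ![f, g, h] N
  have := ((hs 0).mul (hs 1)).mul (hs 2)
  rw [pairProds_assoc] at this
  exact this.coeff_eq ((hs 0).mul ((hs 1).mul (hs 2))) hφ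

protected theorem one_mul (f : BigWitt A) : 1 * f = f := by
  refine ext_coeff fun N => ?_
  obtain ⟨B, _, φ, s, hφ, hs⟩ := exists_splitsUpTo ![f] N
  have := (splitsUpTo_ofRoots N φ {1}).mul (hs 0)
  rw [Multiset.map_singleton, map_one, ofRoots_singleton_one, ← Multiset.cons_zero,
    pairProds_cons, pairProds_zero] at this
  simp only [one_mul, Multiset.map_id', add_zero] at this
  exact this.coeff_eq (hs 0) hφ

protected theorem add_mul (f g h : BigWitt A) : (f + g) * h = f * h + g * h := by
  refine ext_coeff fun N => ?_
  obtain ⟨B, _, φ, s, hφ, hs⟩ := exists_splitsUpTo ![f, g, h] N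
  have := ((hs 0).add (hs 1)).mul (hs 2)
  rw [pairProds_add] at this
  exact this.coeff_eq (((hs 0).mul (hs 2)).add ((hs 1).mul (hs 2))) hφ

noncomputable instance : CommRing (BigWitt A) :=
  CommRing.ofMinimalAxioms
    (fun f g h => Subtype.ext (mul_assoc f.1 g.1 h.1))
    (fun f => Subtype.ext (one_mul f.1))
    (fun f => Subtype.ext <| (mul_comm _ _).trans <|
      PowerSeries.mul_invOfUnit f.1 1 (by rw [f.2, Units.val_one]))
    BigWitt.mul_assoc
    BigWitt.mul_comm
    BigWitt.one_mul
    (fun f g h => by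
      rw [BigWitt.mul_comm, BigWitt.add_mul, BigWitt.mul_comm g, BigWitt.mul_comm h])

/-- The Teichmüller element `1 + a t` of `W(A)`. -/
noncomputable def teichmuller : A →* BigWitt A where
  toFun a := ofRoots {a}
  map_one' := ofRoots_singleton_one
  map_mul' a b := by rw [← ofRoots_pairProds]; simp [pairProds]

theorem sum_map_teichmuller (s : Multiset A) : (s.map teichmuller).sum = ofRoots s := by
  induction s using Multiset.induction_on with
  | empty => exact ofRoots_zero.symm
  | cons a s ih =>
    rw [Multiset.map_cons, Multiset.sum_cons, ih, ← Multiset.singleton_add, ofRoots_add]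
    rfl

theorem esymm_map_teichmuller (s : Multiset A) (n : ℕ) :
    (s.map teichmuller).esymm n = ofRoots (subsetProds n s) := by
  rw [← sum_map_teichmuller, ← subsetProds_map]
  rfl

end Ring

section Truncation

variable {A B : Type*} [CommRing A] [CommRing B]

/-- The image of a series under a ring homomorphism of the coefficients; it is bundled as the
ring homomorphism `BigWitt.map` below. -/
noncomputable def mapCoeffs (φ : A →+* B) (f : BigWitt A) : BigWitt B :=
  ofCoeffs fun n => φ (f.coeff n)

theorem coeff_mapCoeffs (φ : A →+* B) (f : BigWitt A) (n : ℕ) :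
    (mapCoeffs φ f).coeff n = φ (f.coeff n) :=
  coeff_ofCoeffs (by rw [coeff_zero, map_one]) n

theorem mapCoeffs_ofRoots (φ : A →+* B) (s : Multiset A) :
    mapCoeffs φ (ofRoots s) = ofRoots (s.map φ) :=
  ext_coeff fun n => by rw [coeff_mapCoeffs, coeff_ofRoots, coeff_ofRoots, esymm_map_ringHom]

/-- The ring homomorphism `W(φ) : W(A) → W(B)`. -/
noncomputable def map (φ : A →+* B) : BigWitt A →+* BigWitt B where
  toFun := mapCoeffs φ
  map_zero' := by rw [← ofRoots_zero, mapCoeffs_ofRoots, Multiset.map_zero, ofRoots_zero]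
  map_one' := by
    rw [← ofRoots_singleton_one, mapCoeffs_ofRoots, Multiset.map_singleton, map_one,
      ofRoots_singleton_one]
  map_add' f g := ext_coeff fun n => by
    simp only [coeff_mapCoeffs, coeff_add, map_sum, map_mul]
  map_mul' f g := ext_coeff fun n => by
    simp only [coeff_mapCoeffs, coeff_mul, map_aeval_int]
    congr 2
    ext i
    rcases i with i | i <;> rfl

theorem coeff_map (φ : A →+* B) (f : BigWitt A) (n : ℕ) : (map φ f).coeff n = φ (f.coeff n) :=
  coeff_mapCoeffs φ f n

variable (A) in
/-- The congruence on `W(A)` of power series modulo `t ^ (N + 1)`. -/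
def truncCon (N : ℕ) : RingCon (BigWitt A) where
  r f g := ∀ k ≤ N, f.coeff k = g.coeff k
  iseqv := ⟨fun _ _ _ => rfl, fun h k hk => (h k hk).symm,
    fun h h' k hk => (h k hk).trans (h' k hk)⟩
  add' {f f' g g'} h h' k hk := by
    simp only [coeff_add]
    refine Finset.sum_congr rfl fun p hp => ?_
    have := Finset.HasAntidiagonal.mem_antidiagonal.1 hp
    rw [h _ (by omega), h' _ (by omega)]
  mul' {f f' g g'} h h' k hk := by
    simp only [coeff_mul]
    congr 2
    ext i
    rcases i with i | i
    · exact h _ (i.2.trans_le hk)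
    · exact h' _ (i.2.trans_le hk)

/-- The composite of `W(φ) : W(A) → W(B)` with truncation modulo `t ^ (N + 1)`. -/
noncomputable def truncMap (N : ℕ) (φ : A →+* B) : BigWitt A →+* (truncCon B N).Quotient :=
  (truncCon B N).mk'.comp (map φ)

universe u

theorem eq_of_truncMap_eq {A : Type u} [CommRing A] {f g : BigWitt A}
    (h : ∀ N, ∃ (B : Type u) (_ : CommRing B) (φ : A →+* B), Function.Injective φ ∧
      truncMap N φ f = truncMap N φ g) : f = g := by
  refine ext_coeff fun N => ?_
  obtain ⟨B, _, φ, hφ, h⟩ := h N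
  apply hφ
  rw [← coeff_map, ← coeff_map]
  exact (RingCon.eq _).1 h N le_rfl

theorem SplitsUpTo.truncMap_eq {N : ℕ} {φ : A →+* B} {f : BigWitt A} {s : Multiset B}
    (h : SplitsUpTo N φ f s) : truncMap N φ f = (truncCon B N).mk' (ofRoots s) :=
  (RingCon.eq _).2 fun k hk => by rw [coeff_map, h k hk, coeff_ofRoots]

theorem SplitsUpTo.truncMap_lam {N k : ℕ} {φ : A →+* B} {f : BigWitt A} {s : Multiset B}
    (h : SplitsUpTo (N * k) φ f s) :
    truncMap N φ (BigWitt.lam k f) = (truncCon B N).mk' ((s.map teichmuller).esymm k) := by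
  rw [h.lam.truncMap_eq, esymm_map_teichmuller]

end Truncation

section LambdaStructure

variable {A : Type*} [CommRing A]

theorem lam_zero (f : BigWitt A) : lam 0 f = 1 := by
  refine ext_coeff fun N => ?_
  have h : SplitsUpTo (N * 0) (RingHom.id A) f 0 := fun k hk => by
    rw [Nat.le_zero.1 hk, coeff_zero, map_one, multiset_esymm_zero]
  rw [← ofRoots_singleton_one, coeff_ofRoots]
  exact h.lam N le_rfl

theorem lam_one (f : BigWitt A) : lam 1 f = f := by
  refine ext_coeff fun N => ?_
  obtain ⟨B, _, φ, s, hφ, hs⟩ := exists_splitsUpTo ![f] N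
  have h : SplitsUpTo (N * 1) φ f (s 0) := (mul_one N).symm ▸ hs 0
  refine SplitsUpTo.coeff_eq h.lam ?_ hφ
  simpa [subsetProds, Multiset.powersetCard_one] using hs 0

theorem lam_add (n : ℕ) (f g : BigWitt A) :
    lam n (f + g) = ∑ p ∈ Finset.HasAntidiagonal.antidiagonal n, lam p.1 f * lam p.2 g := by
  refine eq_of_truncMap_eq fun N => ?_
  obtain ⟨B, _, φ, s, hφ, hs⟩ := exists_splitsUpTo ![f, g] (N * n)
  have hf : SplitsUpTo (N * n) φ f (s 0) := hs 0
  have hg : SplitsUpTo (N * n) φ g (s 1) := hs 1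
  refine ⟨B, inferInstance, φ, hφ, ?_⟩
  rw [(hf.add hg).truncMap_lam, Multiset.map_add, esymm_add, map_sum, map_sum]
  refine Finset.sum_congr rfl fun p hp => ?_
  have := Finset.HasAntidiagonal.mem_antidiagonal.1 hp
  have hle {k : ℕ} (hk : k ≤ n) : N * k ≤ N * n := Nat.mul_le_mul_left N hk
  rw [map_mul, map_mul]
  rw [(hf.mono (hle (by omega))).truncMap_lam, (hg.mono (hle (by omega))).truncMap_lam]

theorem lam_mul (n : ℕ) (f g : BigWitt A) :
    lam n (f * g) = aeval (Sum.elim (fun i : Fin n => lam (i + 1) f)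
      (fun j : Fin n => lam (j + 1) g)) (prodPoly n) := by
  refine eq_of_truncMap_eq fun N => ?_
  obtain ⟨B, _, φ, s, hφ, hs⟩ := exists_splitsUpTo ![f, g] (N * n)
  have hf : SplitsUpTo (N * n) φ f (s 0) := hs 0
  have hg : SplitsUpTo (N * n) φ g (s 1) := hs 1
  refine ⟨B, inferInstance, φ, hφ, ?_⟩
  have hle (i : Fin n) : N * (i + 1) ≤ N * n := Nat.mul_le_mul_left N i.2
  rw [(hf.mul hg).truncMap_lam, ← pairProds_map, ← aeval_esymm_prodPoly, map_aeval_int,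
    map_aeval_int]
  congr 2
  ext i
  rcases i with i | i
  · exact (hf.mono (hle i)).truncMap_lam.symm
  · exact (hg.mono (hle i)).truncMap_lam.symm

theorem lam_lam (m n : ℕ) (f : BigWitt A) :
    lam m (lam n f) = aeval (fun i : Fin (m * n) => lam (i + 1) f) (compPoly m n) := by
  refine eq_of_truncMap_eq fun N => ?_
  obtain ⟨B, _, φ, s, hφ, hs⟩ := exists_splitsUpTo ![f] (N * m * n)
  have hf : SplitsUpTo (N * m * n) φ f (s 0) := hs 0
  refine ⟨B, inferInstance, φ, hφ, ?_⟩
  have hle (i : Fin (m * n)) : N * (i + 1) ≤ N * m * n :=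
    mul_assoc N m n ▸ Nat.mul_le_mul_left N i.2
  rw [hf.lam.truncMap_lam, ← subsetProds_map, ← aeval_esymm_compPoly, map_aeval_int,
    map_aeval_int]
  congr 2
  exact funext fun i => (hf.mono (hle i)).truncMap_lam.symm

theorem lam_teichmuller (a : A) {n : ℕ} (hn : 1 < n) : lam n (teichmuller a) = 0 := by
  refine (lam_ofRoots n {a}).trans ?_
  rw [subsetProds, Multiset.powersetCard_eq_empty n (by simpa using hn), Multiset.map_zero,
    ofRoots_zero]

noncomputable instance : LambdaRing (BigWitt A) where
  lam := lam
  lam_zero := lam_zero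
  lam_one := lam_one
  lam_add := lam_add
  lam_unit _ hn := map_one (teichmuller (A := A)) ▸ lam_teichmuller 1 hn
  lam_mul := lam_mul
  lam_lam := lam_lam

theorem isStandard (A : Type*) [CommRing A] : IsStandard A :=
  ⟨rfl, rfl, fun _ _ => rfl, fun _ _ => rfl, fun _ _ => rfl⟩

theorem isLineElement_teichmuller (a : A) : IsLineElement (teichmuller a) :=
  fun _ hn => lam_teichmuller a hn

end LambdaStructure

section LambdaSeries

variable {R A : Type*} [CommRing R] [LambdaRing R] [CommRing A]

theorem coeff_ofCoeffs_lam (φ : R →+* A) (x : R) (n : ℕ) :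
    (ofCoeffs fun k => φ (LambdaRing.lam k x)).coeff n = φ (LambdaRing.lam n x) :=
  coeff_ofCoeffs (by rw [LambdaRing.lam_zero, map_one]) n

/-- The homomorphism `x ↦ ∑ φ(λ^n(x)) t^n` from a `λ`-ring `R` to `W(A)`, for `φ : R → A`. -/
noncomputable def lamSeries (φ : R →+* A) : R →+* BigWitt A :=
  RingHom.mk'
    { toFun x := ofCoeffs fun n => φ (LambdaRing.lam n x)
      map_one' := ext_coeff fun n => by
        rw [coeff_ofCoeffs_lam, ← ofRoots_singleton_one, coeff_ofRoots]
        rcases n with _ | _ | n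
        · rw [LambdaRing.lam_zero, map_one, multiset_esymm_zero]
        · simp [LambdaRing.lam_one, Multiset.esymm, Multiset.powersetCard_one]
        · rw [LambdaRing.lam_unit _ (by omega), map_zero, esymm_eq_zero_of_card_lt _ _ (by simp)]
      map_mul' x y := ext_coeff fun n => by
        simp only [coeff_mul, coeff_ofCoeffs_lam]
        rw [LambdaRing.lam_mul, map_aeval_int]
        congr 2
        funext i
        rcases i with i | i <;> rfl }
    fun x y => ext_coeff fun n => by
      simp only [MonoidHom.coe_mk, OneHom.coe_mk, coeff_add, coeff_ofCoeffs_lam]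
      rw [LambdaRing.lam_add, map_sum]
      simp only [map_mul]

theorem coeff_lamSeries (φ : R →+* A) (x : R) (n : ℕ) :
    (lamSeries φ x).coeff n = φ (LambdaRing.lam n x) :=
  coeff_ofCoeffs_lam φ x n

theorem lamSeries_injective {φ : R →+* A} (hφ : Function.Injective φ) :
    Function.Injective (lamSeries φ) := fun x y h => hφ <| by
  simpa only [coeff_lamSeries, LambdaRing.lam_one] using congrArg (coeff 1) h

theorem lamSeries_lam (φ : R →+* A) (m : ℕ) (x : R) :
    lamSeries φ (LambdaRing.lam m x) = LambdaRing.lam m (lamSeries φ x) := by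
  refine ext_coeff fun n => ?_
  refine Eq.trans ?_ (coeff_lam m (lamSeries φ x) n).symm
  simp only [coeff_lamSeries, LambdaRing.lam_lam, map_aeval_int]

end LambdaSeries

end BigWitt

section Rationality

variable {E : Type*} [Field E]

theorem exists_strictAnti_det_ne_zero {ι : Type*} [LinearOrder ι] {N : ℕ} {v : ι → Fin N → E}
    (hv : Submodule.span E (Set.range v) = ⊤) :
    ∃ k : Fin N → ι, StrictAnti k ∧ (Matrix.of fun i => v (k i)).det ≠ 0 := by
  let b₀ := Module.Basis.ofSpan hv.ge
  let b := b₀.reindex (b₀.indexEquiv (Pi.basisFun E (Fin N)))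
  have hb (i : Fin N) : ∃ k, v k = b i :=
    Module.Basis.ofSpan_subset hv.ge (by simp [b, b₀])
  choose k hk using hb
  let σ := Tuple.sort (OrderDual.toDual ∘ k)
  have hinj : Function.Injective k := fun i j hij => b.injective <| by rw [← hk, ← hk, hij]
  refine ⟨k ∘ σ, (Tuple.monotone_sort (OrderDual.toDual ∘ k)).strictMono_of_injective
    (hinj.comp σ.injective), IsUnit.ne_zero ?_⟩
  rw [← Matrix.isUnit_iff_isUnit_det, ← Matrix.linearIndependent_rows_iff_isUnit]
  have : (Matrix.of fun i => v ((k ∘ σ) i)).row = b ∘ σ := funext fun i => hk (σ i)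
  exact this ▸ b.linearIndependent.comp σ σ.injective

theorem exists_ne_zero_dotProduct_eq_zero {ι : Type*} [LinearOrder ι] {N : ℕ} {v : ι → Fin N → E}
    (hdet : ∀ k : Fin N → ι, StrictAnti k → (Matrix.of fun i => v (k i)).det = 0) :
    ∃ c ≠ 0, ∀ k, c ⬝ᵥ v k = 0 := by
  have hspan : Submodule.span E (Set.range v) ≠ ⊤ := fun h =>
    have ⟨k, hk, hk'⟩ := exists_strictAnti_det_ne_zero h
    hk' (hdet k hk)
  obtain ⟨f, hf₀, hf⟩ := Submodule.exists_le_ker_of_lt_top _ hspan.lt_top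
  obtain ⟨c, rfl⟩ := (dotProductEquiv E (Fin N)).surjective f
  exact ⟨c, by simpa using hf₀, fun k => hf (Submodule.subset_span ⟨k, rfl⟩)⟩

theorem exists_polynomial_eq_mk_mul_of_recurrence {A : Type*} [CommSemiring A] {h : ℕ → A}
    {M N : ℕ} {c : Fin N → A} (hc : c ≠ 0) (hrec : ∀ k, M ≤ k → ∑ j : Fin N, c j * h (k + j) = 0) :
    ∃ p q : Polynomial A, q ≠ 0 ∧ (p : PowerSeries A) = PowerSeries.mk h * q := by
  let q : Polynomial A := ∑ j : Fin N, Polynomial.C (c j) * Polynomial.X ^ (j.rev : ℕ)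
  have hq : q ≠ 0 := by
    obtain ⟨i, hi⟩ := Function.ne_iff.1 hc
    have coeff_rev : q.coeff i.rev = c i := by
      simp only [q, Polynomial.finsetSum_coeff, Polynomial.coeff_C_mul_X_pow, Fin.val_inj,
        Fin.rev_inj, Finset.sum_ite_eq, Finset.mem_univ, if_true]
    exact fun h0 => hi (by simpa [h0] using coeff_rev.symm)
  have hcoeff (n : ℕ) (hn : M + N ≤ n) : (PowerSeries.mk h * (q : PowerSeries A)).coeff n = 0 := by
    rw [← hrec (n - N + 1) (by omega)]
    simp only [q, ← Polynomial.coeToPowerSeries.ringHom_apply, map_sum, Finset.mul_sum]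
    refine Finset.sum_congr rfl fun j _ => ?_
    have := j.rev.2
    rw [Polynomial.coeToPowerSeries.ringHom_apply, Polynomial.coe_mul, Polynomial.coe_C,
      Polynomial.coe_pow, Polynomial.coe_X, mul_left_comm, PowerSeries.coeff_C_mul,
      PowerSeries.coeff_mul_X_pow', if_pos (by omega), PowerSeries.coeff_mk,
      show n - j.rev = n - N + 1 + j by rw [Fin.val_rev]; omega]
  refine ⟨PowerSeries.trunc (M + N) (PowerSeries.mk h * q), q, hq, PowerSeries.ext fun n => ?_⟩
  rw [Polynomial.coeff_coe, PowerSeries.coeff_trunc]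
  split_ifs with hn
  · rfl
  · exact (hcoeff n (not_lt.1 hn)).symm

theorem exists_coeff_zero_eq_one_of_eq_mul {f : PowerSeries E} (hf : f.coeff 0 = 1)
    {p q : Polynomial E} (hq : q ≠ 0) (h : (p : PowerSeries E) = f * q) :
    ∃ p' q' : Polynomial E, p'.coeff 0 = 1 ∧ q'.coeff 0 = 1 ∧ (p' : PowerSeries E) = f * q' := by
  obtain ⟨q₁, hq₁, hX⟩ := q.exists_eq_pow_rootMultiplicity_mul_and_not_dvd hq 0
  rw [Polynomial.C_0, sub_zero] at hq₁ hX
  rw [Polynomial.X_dvd_iff] at hX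
  set a := q.rootMultiplicity 0
  have hpX : (p : PowerSeries E) = PowerSeries.X ^ a * (f * (q₁ : PowerSeries E)) := by
    rw [h, hq₁, Polynomial.coe_mul, Polynomial.coe_pow, Polynomial.coe_X, mul_left_comm]
  obtain ⟨p₁, rfl⟩ : Polynomial.X ^ a ∣ p := Polynomial.X_pow_dvd_iff.2 fun d hd => by
    rw [← Polynomial.coeff_coe]
    exact PowerSeries.X_pow_dvd_iff.1 ⟨_, hpX⟩ d hd
  have h₁ : (p₁ : PowerSeries E) = f * q₁ := by
    rw [Polynomial.coe_mul, Polynomial.coe_pow, Polynomial.coe_X] at hpX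
    exact mul_left_cancel₀ (pow_ne_zero a PowerSeries.X_ne_zero) hpX
  have hcoeff : p₁.coeff 0 = q₁.coeff 0 := by
    rw [← Polynomial.coeff_coe, h₁]
    simp [PowerSeries.coeff_mul, hf]
  refine ⟨Polynomial.C (q₁.coeff 0)⁻¹ * p₁, Polynomial.C (q₁.coeff 0)⁻¹ * q₁, ?_, ?_, ?_⟩
  · rw [Polynomial.coeff_C_mul, hcoeff, inv_mul_cancel₀ hX]
  · rw [Polynomial.coeff_C_mul, inv_mul_cancel₀ hX]
  · rw [Polynomial.coe_mul, Polynomial.coe_mul, h₁, mul_left_comm]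

theorem exists_esymm_eq_mul_esymm [IsAlgClosed E] {f : PowerSeries E} (hf : f.coeff 0 = 1)
    {p q : Polynomial E} (hq : q ≠ 0) (h : (p : PowerSeries E) = f * q) :
    ∃ s t : Multiset E, PowerSeries.mk s.esymm = f * PowerSeries.mk t.esymm := by
  obtain ⟨p, q, hp, hq, h⟩ := exists_coeff_zero_eq_one_of_eq_mul hf hq h
  obtain ⟨s, hs⟩ := exists_multiset_esymm_eq_coeff hp
  obtain ⟨t, ht⟩ := exists_multiset_esymm_eq_coeff hq
  exact ⟨s, t, by rw [funext hs, funext ht]; exact h⟩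

end Rationality

section SchurFinite

theorem mk_elemSym_mul_rescale_completeSym :
    PowerSeries.mk elemSym * PowerSeries.rescale (-1) (PowerSeries.mk completeSym) = 1 := by
  have hcomplete : PowerSeries.mk completeSym =
      PowerSeries.invOfUnit (PowerSeries.mk fun k => (-1) ^ k * elemSym k) 1 :=
    PowerSeries.ext fun n => PowerSeries.coeff_mk n _
  have hsign : PowerSeries.mk elemSym =
      PowerSeries.rescale (-1) (PowerSeries.mk fun k => (-1) ^ k * elemSym k) := by
    ext1 n
    rw [PowerSeries.coeff_rescale, PowerSeries.coeff_mk, PowerSeries.coeff_mk, ← mul_assoc,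
      ← mul_pow, neg_mul_neg, one_mul, one_pow, one_mul]
  rw [hcomplete, hsign, ← map_mul,
    PowerSeries.mul_invOfUnit _ 1 (by simp [elemSym]), map_one]

theorem antitone_add_val_of_strictAnti {N : ℕ} {k : Fin N → ℕ} (hk : StrictAnti k) :
    Antitone fun i => k i + i := by
  rcases N with _ | N
  · exact fun i => i.elim0
  · refine Fin.antitone_iff_succ_le.2 fun i => ?_
    have := hk (Fin.castSucc_lt_succ (i := i))
    simp only [Fin.val_succ, Fin.val_castSucc]
    omega

theorem exists_youngDiagram_rowLen_eq {N : ℕ} {r : Fin N → ℕ} (hr : Antitone r) :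
    ∃ μ : YoungDiagram, μ.colLen 0 ≤ N ∧ ∀ i : Fin N, μ.rowLen i = r i := by
  let μ := YoungDiagram.ofRowLens (List.ofFn r) hr.sortedGE_ofFn
  have mem_iff (i j : ℕ) : (i, j) ∈ μ ↔ ∃ h : i < N, j < r ⟨i, h⟩ := by
    simp [μ, YoungDiagram.mem_ofRowLens]
  refine ⟨μ, ?_, fun i => eq_of_forall_lt_iff fun j => ?_⟩
  · by_contra! h
    obtain ⟨h', -⟩ := (mem_iff N 0).1 (YoungDiagram.mem_iff_lt_colLen.2 h)
    exact lt_irrefl _ h'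
  · rw [← YoungDiagram.mem_iff_lt_rowLen, mem_iff]
    exact ⟨fun ⟨_, h⟩ => h, fun h => ⟨i.2, h⟩⟩

theorem youngDiagram_le_of_rowLen_zero_le {ν μ : YoungDiagram}
    (h : ∀ i < ν.colLen 0, ν.rowLen 0 ≤ μ.rowLen i) : ν ≤ μ := by
  rintro ⟨i, j⟩ hij
  have hi : i < ν.colLen 0 :=
    YoungDiagram.mem_iff_lt_colLen.1 (ν.up_left_mem le_rfl j.zero_le hij)
  have hj : j < ν.rowLen 0 :=
    YoungDiagram.mem_iff_lt_rowLen.1 (ν.up_left_mem i.zero_le le_rfl hij)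
  exact YoungDiagram.mem_iff_lt_rowLen.2 (hj.trans_le (h i hi))

theorem exists_schur_eq_det_completeSym {N : ℕ} {k : Fin N → ℕ} (hk : StrictAnti k) :
    ∃ μ : YoungDiagram, (∀ i : Fin N, μ.rowLen i = k i + i) ∧
      schur μ = (Matrix.of fun i j : Fin N => completeSym (k i + j)).det := by
  obtain ⟨μ, hcol, hrow⟩ := exists_youngDiagram_rowLen_eq (antitone_add_val_of_strictAnti hk)
  refine ⟨μ, hrow, ?_⟩
  rw [← jt_det_stable μ N hcol]
  congr 1
  ext1 i j
  have : ((k i + i : ℕ) : ℤ) + j - i = (k i + j : ℕ) := by push_cast; ring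
  rw [jt, Matrix.of_apply, Matrix.of_apply, hrow, this, completeSymInt, if_neg (by omega),
    Int.toNat_natCast]

theorem det_map_completeSym_eq_zero {A : Type*} [CommRing A] {ψ : SymFun →+* A} {ν : YoungDiagram}
    (hν : ∀ μ, ν ≤ μ → ψ (schur μ) = 0) {k : Fin (ν.colLen 0) → ℕ} (hk : StrictAnti k)
    (hle : ∀ i, ν.rowLen 0 ≤ k i) :
    (Matrix.of fun i j : Fin (ν.colLen 0) => ψ (completeSym (k i + j))).det = 0 := by
  obtain ⟨μ, hrow, hμ⟩ := exists_schur_eq_det_completeSym hk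
  have hνμ : ν ≤ μ := youngDiagram_le_of_rowLen_zero_le fun i hi =>
    (hle ⟨i, hi⟩).trans ((Nat.le_add_right _ _).trans_eq (hrow ⟨i, hi⟩).symm)
  rw [← hν μ hνμ, hμ, RingHom.map_det]
  rfl

theorem exists_map_mk_elemSym_mul_eq {E : Type*} [Field E] [IsAlgClosed E] {ψ : SymFun →+* E}
    {ν : YoungDiagram} (hν : ∀ μ, ν ≤ μ → ψ (schur μ) = 0) :
    ∃ s t : Multiset E, PowerSeries.map ψ (PowerSeries.mk elemSym) * PowerSeries.mk t.esymm =
      PowerSeries.mk s.esymm := by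
  let h : ℕ → E := fun n => ψ (completeSym n)
  have hH : PowerSeries.map ψ (PowerSeries.mk elemSym) *
      PowerSeries.rescale (-1) (PowerSeries.mk h) = 1 := by
    rw [← map_one (PowerSeries.map ψ), ← mk_elemSym_mul_rescale_completeSym, map_mul]
    congr 1
    ext n
    simp only [PowerSeries.coeff_map, PowerSeries.coeff_rescale, PowerSeries.coeff_mk, map_mul,
      map_pow, map_neg, map_one, h]
  obtain ⟨c, hc, hrec⟩ := exists_ne_zero_dotProduct_eq_zero
    (v := fun (k : Set.Ici (ν.rowLen 0)) (j : Fin (ν.colLen 0)) => h (k + j))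
    fun k hk => det_map_completeSym_eq_zero hν hk fun i => (k i).2
  obtain ⟨p, q, hq, hpq⟩ :=
    exists_polynomial_eq_mk_mul_of_recurrence hc fun k hk => hrec ⟨k, hk⟩
  obtain ⟨s, t, hst⟩ := exists_esymm_eq_mul_esymm (by simp [h, completeSym_zero]) hq hpq
  have mk_esymm_neg (u : Multiset E) : PowerSeries.mk (u.map Neg.neg).esymm =
      PowerSeries.rescale (-1) (PowerSeries.mk u.esymm) := by
    ext n
    rw [PowerSeries.coeff_rescale, PowerSeries.coeff_mk, PowerSeries.coeff_mk, Multiset.esymm_neg]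
  refine ⟨t.map Neg.neg, s.map Neg.neg, ?_⟩
  rw [mk_esymm_neg, mk_esymm_neg, hst, map_mul, ← mul_assoc, hH, one_mul]

theorem symOp_elemSym {R : Type*} [CommRing R] [LambdaRing R] (n : ℕ) (x : R) :
    symOp (elemSym n) x = LambdaRing.lam n x := by
  rcases n with _ | n
  · simp [symOp, elemSym, LambdaRing.lam_zero]
  · simp [symOp, elemSym]

namespace BigWitt

theorem lamSeries_eq_ofRoots_sub_ofRoots {R E : Type*} [CommRing R] [LambdaRing R] [Field E]
    [IsAlgClosed E] (φ : R →+* E) {x : R} (hx : IsSchurFinite x) :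
    ∃ s t : Multiset E, lamSeries φ x = ofRoots s - ofRoots t := by
  obtain ⟨ν, hν⟩ := hx
  let ψ : SymFun →+* E :=
    φ.comp (aeval fun k => LambdaRing.lam (k + 1) x : SymFun →ₐ[ℤ] R).toRingHom
  have map_schur (μ : YoungDiagram) (hμ : ν ≤ μ) : ψ (schur μ) = 0 :=
    (congrArg φ (hν μ hμ)).trans (map_zero φ)
  have hlam : (lamSeries φ x).1 = PowerSeries.map ψ (PowerSeries.mk elemSym) := by
    ext n
    refine (coeff_lamSeries φ x n).trans ?_
    rw [PowerSeries.coeff_map, PowerSeries.coeff_mk, ← symOp_elemSym]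
    rfl
  have hroots (u : Multiset E) : (ofRoots u).1 = PowerSeries.mk u.esymm :=
    PowerSeries.ext fun n => (coeff_ofRoots u n).trans (PowerSeries.coeff_mk n _).symm
  obtain ⟨s, t, h⟩ := exists_map_mk_elemSym_mul_eq map_schur
  rw [← hlam, ← hroots, ← hroots] at h
  exact ⟨s, t, eq_sub_of_add_eq (Subtype.ext h)⟩

theorem exists_ofRoots_eq_sum_isLineElement {A : Type*} [CommRing A] (s : Multiset A) :
    ∃ (n : ℕ) (l : Fin n → BigWitt A), (∀ i, IsLineElement (l i)) ∧ ofRoots s = ∑ i, l i := by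
  obtain ⟨a, ha⟩ := exists_univ_map_eq (s := s) rfl
  refine ⟨s.card, fun i => teichmuller (a i), fun i => isLineElement_teichmuller _, ?_⟩
  conv_lhs => rw [← ha, ← sum_map_teichmuller, Multiset.map_map]
  rfl

end BigWitt

end SchurFinite

end LambdaTheory

open LambdaTheory in
theorem mainTheorem5_general {R E : Type*} [CommRing R] [LambdaRing R] [Field E] [IsAlgClosed E]
    {φ : R →+* E} (hφ : Function.Injective φ) :
    BigWitt.IsStandard E ∧ ∃ ι : R →+* BigWitt E, Function.Injective ι ∧
      (∀ (n : ℕ) (x : R), ι (LambdaRing.lam n x) = LambdaRing.lam n (ι x)) ∧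
      (∀ (n : ℕ) (x : R), (ι x).coeff n = φ (LambdaRing.lam n x)) ∧
      ∀ x : R, IsSchurFinite x → ∃ (p q : ℕ) (l : Fin p → BigWitt E) (l' : Fin q → BigWitt E),
        (∀ i, IsLineElement (l i)) ∧ (∀ j, IsLineElement (l' j)) ∧ ι x = ∑ i, l i - ∑ j, l' j := by
  refine ⟨BigWitt.isStandard E, BigWitt.lamSeries φ, BigWitt.lamSeries_injective hφ,
    fun n x => BigWitt.lamSeries_lam φ n x, fun n x => BigWitt.coeff_lamSeries φ x n,
    fun x hx => ?_⟩
  obtain ⟨s, t, hst⟩ := BigWitt.lamSeries_eq_ofRoots_sub_ofRoots φ hx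
  obtain ⟨p, l, hl, hs⟩ := BigWitt.exists_ofRoots_eq_sum_isLineElement s
  obtain ⟨q, l', hl', ht⟩ := BigWitt.exists_ofRoots_eq_sum_isLineElement t
  exact ⟨p, q, l, l', hl, hl', by rw [hst, hs, ht]⟩

theorem mainTheorem5 (R : Type*) [CommRing R] [IsDomain R] [LambdaTheory.LambdaRing R] :
    ∃ (_ : CommRing (LambdaTheory.BigWitt (AlgebraicClosure (FractionRing R))))
      (_ : LambdaTheory.LambdaRing (LambdaTheory.BigWitt (AlgebraicClosure (FractionRing R)))),
      LambdaTheory.BigWitt.IsStandard (AlgebraicClosure (FractionRing R)) ∧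
      ∃ ι : R →+* LambdaTheory.BigWitt (AlgebraicClosure (FractionRing R)),
        Function.Injective ι ∧
        (∀ (n : ℕ) (x : R), ι (LambdaTheory.LambdaRing.lam n x) =
          LambdaTheory.LambdaRing.lam n (ι x)) ∧
        (∀ (n : ℕ) (x : R), (ι x).coeff n =
          algebraMap R (AlgebraicClosure (FractionRing R)) (LambdaTheory.LambdaRing.lam n x)) ∧
        ∀ x : R, LambdaTheory.IsSchurFinite x →
          ∃ (p q : ℕ) (l : Fin p → LambdaTheory.BigWitt (AlgebraicClosure (FractionRing R)))
            (l' : Fin q → LambdaTheory.BigWitt (AlgebraicClosure (FractionRing R))),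
            (∀ i, LambdaTheory.IsLineElement (l i)) ∧
            (∀ j, LambdaTheory.IsLineElement (l' j)) ∧
            ι x = ∑ i, l i - ∑ j, l' j := by
  have hinj : Function.Injective (algebraMap R (AlgebraicClosure (FractionRing R))) := by
    rw [IsScalarTower.algebraMap_eq R (FractionRing R) (AlgebraicClosure (FractionRing R))]
    exact (algebraMap (FractionRing R) _).injective.comp
      (IsFractionRing.injective R (FractionRing R))
  exact ⟨inferInstance, inferInstance, mainTheorem5_general hinj⟩
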